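/- Let $R$ be a ring; "module" means $R$-module (all on the same fixed side). For a class $\mathcal C$ of modules, a module $M$ is $\mathcal C$-filtered if there are an ordinal $\sigma$ and an increasing chain of submodules $(M_\alpha \mid \alpha\le\sigma)$ of $M$ with $M_0=0$, $M_\sigma=M$, $M_\alpha=\bigcup_{\beta<\alpha}M_\beta$ for every limit ordinal $\alpha\le\sigma$, and $M_{\alpha+1}/M_\alpha$ isomorphic to an element of $\mathcal C$ for every $\alpha<\sigma$. A class $\mathcal A$ is closed under transfinite extensions if every $\mathcal A$-filtered module belongs to $\mathcal A$. For a cardinal $\kappa$, a module is $\le\kappa$-presented if it is isomorphic to $F/K$ with $F$ free on a set of cardinality at most $\kappa$ and $K$ generated by at most $\kappa$ elements. Let $\mathcal A^{\le\kappa}$ be the class of all $\le\kappa$-presented modules in $\mathcal A$, and $\mathcal A(\kappa)$ the class of all $\mathcal A^{\le\kappa}$-filtered modules. Put $\mathcal C^{\perp}=\{N\mid \operatorname{Ext}^1_R(M,N)=0\text{ for all }M\in\mathcal C\}$ and ${}^{\perp}\mathcal C=\{M\mid \operatorname{Ext}^1_R(M,N)=0\text{ for all }N\in\mathcal C\}$.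 A pair $(\mathcal X,\mathcal Y)$ of classes of modules is a cotorsion pair if $\mathcal X={}^{\perp}\mathcal Y$ and $\mathcal Y=\mathcal X^{\perp}$; it is complete if moreover for each module $M$ there is a short exact sequence $0\to M\to Y\to X\to 0$ with $Y\in\mathcal Y$ and $X\in\mathcal X$. **Lemma.** Let $R$ be a ring, $\kappa$ an infinite cardinal, and $\mathcal A$ a class of modules that contains the regular module $R$ and is closed under transfinite extensions and under direct summands. Then $(\mathcal A(\kappa),(\mathcal A^{\le\kappa})^{\perp})$ is a complete cotorsion pair. -/

import Mathlib

open CategoryTheory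

universe u

namespace ModClass

variable {R : Type u} [Ring R]

/-- The family `F α`, `α ≤ σ`, is a `C`-filtration of the module `M`: a continuous increasing chain
of submodules from `0` to `M` whose consecutive factors are isomorphic to members of `C`. (The values
of `F` above `σ` are irrelevant.) -/
structure IsFiltration (C : ObjectProperty (ModuleCat.{u} R)) (M : ModuleCat.{u} R)
    (σ : Ordinal.{u}) (F : Ordinal.{u} → Submodule R M) : Prop where
  zero : F 0 = ⊥
  top : F σ = ⊤
  mono : ∀ α β : Ordinal.{u}, α ≤ β → β ≤ σ → F α ≤ F β
  limit : ∀ α : Ordinal.{u}, α ≤ σ → Order.IsSuccLimit α →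
    (F α : Set M) = ⋃ β ∈ Set.Iio α, (F β : Set M)
  factor : ∀ α : Ordinal.{u}, α < σ → ∃ N : ModuleCat.{u} R, C N ∧
    Nonempty ((F (α + 1) ⧸ (F α).submoduleOf (F (α + 1))) ≃ₗ[R] N)

/-- The class of all `C`-filtered modules. -/
def Filtered (C : ObjectProperty (ModuleCat.{u} R)) : ObjectProperty (ModuleCat.{u} R) :=
  fun M => ∃ (σ : Ordinal.{u}) (F : Ordinal.{u} → Submodule R M), IsFiltration C M σ F

/-- Every `A`-filtered module belongs to `A`. -/
def ClosedUnderTransfiniteExtensions (A : ObjectProperty (ModuleCat.{u} R)) : Prop :=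
  ∀ M : ModuleCat.{u} R, Filtered A M → A M

/-- If `M ≅ N ⊕ N'` belongs to `A`, then so does `N`. -/
def ClosedUnderDirectSummands (A : ObjectProperty (ModuleCat.{u} R)) : Prop :=
  ∀ M N N' : ModuleCat.{u} R, A M → Nonempty (M ≃ₗ[R] N × N') → A N

/-- `M` is `≤ κ`-presented: it is the quotient of a free module of rank at most `κ` by a submodule
that is generated by at most `κ` elements. -/
def IsLePresented (κ : Cardinal.{u}) (M : ModuleCat.{u} R) : Prop :=
  ∃ (ι : Type u) (f : (ι →₀ R) →ₗ[R] M) (S : Set (ι →₀ R)),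
    Cardinal.mk ι ≤ κ ∧ Function.Surjective f ∧
      Cardinal.mk S ≤ κ ∧ Submodule.span R S = LinearMap.ker f

/-- The class of the `≤ κ`-presented modules in `A`. -/
def lePresented (A : ObjectProperty (ModuleCat.{u} R)) (κ : Cardinal.{u}) :
    ObjectProperty (ModuleCat.{u} R) :=
  fun M => A M ∧ IsLePresented κ M

/-- The class `A(κ)` of the modules filtered by `≤ κ`-presented members of `A`. -/
def restricted (A : ObjectProperty (ModuleCat.{u} R)) (κ : Cardinal.{u}) :
    ObjectProperty (ModuleCat.{u} R) :=
  Filtered (lePresented A κ)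

/-- The class of all `M` with `Ext¹(M, N) = 0` for all `N` in `B`. -/
def leftPerp (B : ObjectProperty (ModuleCat.{u} R)) : ObjectProperty (ModuleCat.{u} R) :=
  fun M => ∀ N : ModuleCat.{u} R, B N → Subsingleton (Abelian.Ext M N 1)

/-- The class of all `N` with `Ext¹(M, N) = 0` for all `M` in `A`. -/
def rightPerp (A : ObjectProperty (ModuleCat.{u} R)) : ObjectProperty (ModuleCat.{u} R) :=
  fun N => ∀ M : ModuleCat.{u} R, A M → Subsingleton (Abelian.Ext M N 1)

/-- `(A, B)` is a cotorsion pair. -/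
structure IsCotorsionPair (A B : ObjectProperty (ModuleCat.{u} R)) : Prop where
  left_eq : A = leftPerp B
  right_eq : B = rightPerp A

/-- `(A, B)` is a complete cotorsion pair: moreover, for each module `M` there is a short exact
sequence `0 → M → Y → X → 0` with `Y` in `B` and `X` in `A`. -/
structure IsCompleteCotorsionPair (A B : ObjectProperty (ModuleCat.{u} R)) : Prop
    extends IsCotorsionPair A B where
  complete : ∀ M : ModuleCat.{u} R, ∃ (Y X : ModuleCat.{u} R) (f : M ⟶ Y) (g : Y ⟶ X)
    (w : f ≫ g = 0), B Y ∧ A X ∧ (ShortComplex.mk f g w).ShortExact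

end ModClass

/-! Write κ = |K| and B for the right orthogonal of the ≤ κ-presented members of `A`. By Eklof's
lemma (`subsingleton_ext_of_filtered`), `restricted A κ` lies in the left orthogonal of B. The rest
comes from two constructions, both phrased with block systems: a block system is a filtration by ≤
κ-presented members of `A` together with chosen generators of its factors (`HasBlocks.restricted`).

`exists_special_preenvelope` embeds any M in some Y in B whose cokernel has blocks, which gives
completeness. Instead of iterating pushouts, it adjoins to M at once the unknowns of all formal
systems in `EquationBlock`, whose right hand sides may involve unknowns of other systems;
inconsistent systems are neutralised. A map from a module of relations to Y is then itself given by
such a system, so it extends.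

Let X be left orthogonal to B. Take a free F mapping onto X, and embed the kernel in such a Y, with
cokernel Z. The pushout of F and Y is an extension of X by Y, so it splits, and Y ⊕ X is an
extension of Z by F. As R is in `A`, F has blocks, hence so does Y ⊕ X (`HasBlocks.extension`), and
X is a summand of it. `HasBlocks.restricted_of_retract` then combines the ideas of Hill and
Kaplansky: sets of blocks that are closed under their relations and under the projection cut X into
summands of modules with at most κ blocks. Such modules are ≤ κ-presented and, being `A`-filtered,
lie in `A`; both properties pass to summands.

The recurring tool is a well-founded reduction of leading terms, `inf_biSup_le_of_reduction`. -/

namespace ModClass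

/-! ### Ext¹ as an obstruction to extending maps; Eklof's lemma. -/

section

variable {R : Type u} [Ring R]

/-- If `Ext¹(X, N) = 0`, then maps into `N` extend along every monomorphism with cokernel `X`. -/
theorem exists_extension_of_subsingleton_ext {A B X N : Type u}
    [AddCommGroup A] [AddCommGroup B] [AddCommGroup X] [AddCommGroup N]
    [Module R A] [Module R B] [Module R X] [Module R N]
    (h : Subsingleton (Abelian.Ext (ModuleCat.of R X) (ModuleCat.of R N) 1))
    (i : A →ₗ[R] B) (p : B →ₗ[R] X) (hi : Function.Injective i) (hp : Function.Surjective p)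
    (hip : Function.Exact i p) (f : A →ₗ[R] N) : ∃ g : B →ₗ[R] N, g ∘ₗ i = f := by
  let S : ShortComplex (ModuleCat.{u} R) := ShortComplex.mk (ModuleCat.ofHom i) (ModuleCat.ofHom p)
    (by ext x; exact (hip (i x)).mpr ⟨x, rfl⟩)
  have hS : S.ShortExact := ModuleCat.shortComplex_shortExact S hip hi hp
  obtain ⟨x, hx⟩ := Abelian.Ext.contravariant_sequence_exact₁ hS (ModuleCat.of R N)
    (Abelian.Ext.mk₀ (ModuleCat.ofHom f)) (n₁ := 1) rfl (h.elim _ _)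
  obtain ⟨g, rfl⟩ := Abelian.Ext.homEquiv₀.symm.surjective x
  refine ⟨g.hom, ?_⟩
  have h1 : Abelian.Ext.mk₀ (S.f ≫ g) = Abelian.Ext.mk₀ (ModuleCat.ofHom f) := by
    rw [← hx, ← Abelian.Ext.mk₀_comp_mk₀]; rfl
  have h2 := (Abelian.Ext.mk₀_bijective _ _).1 h1
  exact congrArg ModuleCat.Hom.hom h2

/-- If maps into `N` extend from the kernel of a projective presentation of `X`, then
`Ext¹(X, N) = 0`. -/
theorem subsingleton_ext_of_exists_extension {B X N : Type u}
    [AddCommGroup B] [AddCommGroup X] [AddCommGroup N]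
    [Module R B] [Module R X] [Module R N] [Module.Projective R B]
    (p : B →ₗ[R] X) (hp : Function.Surjective p)
    (h : ∀ f : LinearMap.ker p →ₗ[R] N, ∃ g : B →ₗ[R] N, g ∘ₗ (LinearMap.ker p).subtype = f) :
    Subsingleton (Abelian.Ext (ModuleCat.of R X) (ModuleCat.of R N) 1) := by
  have hS := LinearMap.shortExact_shortComplexKer hp
  refine subsingleton_of_forall_eq 0 fun x => ?_
  have : Projective p.shortComplexKer.X₂ :=
    inferInstanceAs (Projective (ModuleCat.of R B))
  obtain ⟨y, rfl⟩ := Abelian.Ext.contravariant_sequence_exact₃ hS (ModuleCat.of R N) x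
    (Abelian.Ext.eq_zero_of_projective _) (n₀ := 0) rfl
  obtain ⟨f, rfl⟩ := Abelian.Ext.homEquiv₀.symm.surjective y
  obtain ⟨g, hg⟩ := h f.hom
  have : f = p.shortComplexKer.f ≫ ModuleCat.ofHom g := by
    ext z; exact (LinearMap.congr_fun hg z).symm
  have h2 : Abelian.Ext.homEquiv₀.symm f =
      (Abelian.Ext.mk₀ p.shortComplexKer.f).comp (Abelian.Ext.mk₀ (ModuleCat.ofHom g))
        (zero_add 0) := by
    rw [Abelian.Ext.mk₀_comp_mk₀, ← this]; rfl
  rw [h2, ShortComplex.ShortExact.extClass_comp_assoc]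

/-- Eklof's lemma. -/
theorem subsingleton_ext_of_filtered {C : ObjectProperty (ModuleCat.{u} R)} {M N : ModuleCat.{u} R}
    (hM : Filtered C M) (hN : ∀ X, C X → Subsingleton (Abelian.Ext X N 1)) :
    Subsingleton (Abelian.Ext M N 1) := by
  obtain ⟨σ, F, hF⟩ := hM
  let p : (M →₀ R) →ₗ[R] M := Finsupp.linearCombination R id
  have hp : Function.Surjective p := Finsupp.linearCombination_id_surjective R M
  refine subsingleton_ext_of_exists_extension p hp fun f => ?_
  let G : Ordinal.{u} → Submodule R (M →₀ R) := fun α => (F α).comap p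
  have hG : ∀ α β, α ≤ β → β ≤ σ → G α ≤ G β := fun α β h h' =>
    Submodule.comap_mono (hF.mono α β h h')
  have hlim : ∀ α ≤ σ, Order.IsSuccLimit α → ∀ x ∈ G α, ∃ β < α, x ∈ G β := by
    intro α hα hl x hx
    have h1 : p x ∈ (F α : Set M) := hx
    rw [hF.limit α hα hl] at h1
    obtain ⟨β, hβ, h2⟩ := Set.mem_iUnion₂.mp h1
    exact ⟨β, hβ, h2⟩
  let f₀ : (M →₀ R) →ₗ.[R] N := ⟨LinearMap.ker p, f⟩
  -- Domains are restricted to stages `G α`, so that enlarging a maximal map only meets Ext¹ of a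
  -- single factor.
  let 𝒮 : Set ((M →₀ R) →ₗ.[R] N) := {g | (∃ α ≤ σ, g.domain = G α) ∧ f₀ ≤ g}
  obtain ⟨g, hfg, hmax⟩ := zorn_le_nonempty₀ 𝒮 (by
    intro c hc hchain y hy
    have hdir : DirectedOn (· ≤ ·) c := hchain.directedOn
    refine ⟨LinearPMap.sSup c hdir, ⟨?_, (hc hy).2.trans (LinearPMap.le_sSup hdir hy)⟩,
      fun z hz => LinearPMap.le_sSup hdir hz⟩
    -- The union of a chain must again have a stage as domain. It is the least stage containing all
    -- the domains: for every smaller index, some member of the chain has domain `G γ` with a larger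
    -- `γ`.
    let B : Set Ordinal.{u} := {α | α ≤ σ ∧ ∀ z ∈ c, z.domain ≤ G α}
    have hB : B.Nonempty := ⟨σ, le_rfl, fun z hz x _ => by
      change p x ∈ F σ; rw [hF.top]; trivial⟩
    obtain ⟨⟨hασ, hα⟩, hmin⟩ : sInf B ∈ B ∧ ∀ β < sInf B, β ∉ B :=
      ⟨csInf_mem hB, fun β hβ => notMem_of_lt_csInf hβ (OrderBot.bddBelow _)⟩
    have hex : ∀ β < sInf B, ∃ z ∈ c, ∃ γ, β < γ ∧ γ ≤ σ ∧ z.domain = G γ := by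
      intro β hβ
      have h1 : ¬ (β ≤ σ ∧ ∀ z ∈ c, z.domain ≤ G β) := hmin β hβ
      push Not at h1
      obtain ⟨z, hz, hzβ⟩ := h1 (hβ.le.trans hασ)
      obtain ⟨γ, hγ, hzγ⟩ := (hc hz).1
      refine ⟨z, hz, γ, ?_, hγ, hzγ⟩
      by_contra! hle
      exact hzβ (hzγ ▸ hG γ β hle (hβ.le.trans hασ))
    refine ⟨sInf B, hασ, le_antisymm ?_ ?_⟩
    · rw [LinearPMap.domain_sSup]
      exact sSup_le (by rintro _ ⟨z, hz, rfl⟩; exact hα z hz)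
    · intro x hx
      rw [LinearPMap.mem_domain_sSup_iff ⟨y, hy⟩]
      rcases Ordinal.zero_or_succ_or_isSuccLimit (sInf B) with h0 | ⟨β, hβ⟩ | hl
      · rw [h0] at hx
        refine ⟨y, hy, (hc hy).2.1 ?_⟩
        change p x ∈ F 0 at hx
        rw [hF.zero] at hx
        exact hx
      · have hβ' : β < sInf B := by rw [← hβ]; exact Order.lt_succ β
        obtain ⟨z, hz, γ, hβγ, hγ, hzγ⟩ := hex β hβ'
        refine ⟨z, hz, hzγ ▸ hG _ γ ?_ hγ hx⟩
        rw [← hβ]; exact Order.succ_le_of_lt hβγ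
      · obtain ⟨β, hβ, hxβ⟩ := hlim _ hασ hl x hx
        obtain ⟨z, hz, γ, hβγ, hγ, hzγ⟩ := hex β hβ
        exact ⟨z, hz, hzγ ▸ hG _ γ hβγ.le hγ hxβ⟩) f₀
    ⟨⟨0, zero_le, by
      change LinearMap.ker p = (F 0).comap p
      rw [hF.zero]; rfl⟩, le_rfl⟩
  have hdom : g.domain = ⊤ := by
    by_contra hne
    let B : Set Ordinal.{u} := {α | α ≤ σ ∧ ¬ G α ≤ g.domain}
    have hB : B.Nonempty := ⟨σ, le_rfl, fun h => hne (top_le_iff.mp (by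
      have : G σ = ⊤ := by change (F σ).comap p = ⊤; rw [hF.top]; rfl
      rwa [this] at h))⟩
    obtain ⟨⟨hασ, hα⟩, hmin⟩ : sInf B ∈ B ∧ ∀ β < sInf B, β ∉ B :=
      ⟨csInf_mem hB, fun β hβ => notMem_of_lt_csInf hβ (OrderBot.bddBelow _)⟩
    have hlt : ∀ β < sInf B, G β ≤ g.domain := fun β hβ => by
      by_contra h; exact hmin β hβ ⟨hβ.le.trans hασ, h⟩
    rcases Ordinal.zero_or_succ_or_isSuccLimit (sInf B) with h0 | ⟨β, hβ⟩ | hl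
    · apply hα
      intro x hx
      refine hfg.1 ?_
      rw [h0] at hx
      change p x ∈ F 0 at hx
      rw [hF.zero] at hx
      exact hx
    · have hβ' : β < sInf B := by rw [← hβ]; exact Order.lt_succ β
      have hβσ : β < σ := hβ'.trans_le hασ
      have hβ1 : β + 1 ≤ σ := Order.add_one_le_of_lt hβσ
      have hβs : sInf B = β + 1 := hβ.symm
      have hle := hG β (β + 1) (le_add_of_nonneg_right zero_le) hβ1
      -- The domain is a stage, and any stage beyond `β` would contain `G (β + 1)`.
      have hdβ : g.domain = G β := by
        refine le_antisymm ?_ (hlt β hβ')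
        obtain ⟨γ, hγ, hgγ⟩ := hmax.1.1
        rw [hgγ]
        refine hG γ β ?_ hβσ.le
        by_contra! h
        exact hα (hgγ ▸ hG _ γ (by rw [hβs]; exact Order.add_one_le_of_lt h) hγ)
      obtain ⟨X, hX, ⟨e⟩⟩ := hF.factor β hβσ
      let q : G (β + 1) →ₗ[R] X := e.toLinearMap ∘ₗ
        ((F β).submoduleOf (F (β + 1))).mkQ ∘ₗ p.restrict (p := G (β + 1)) (q := F (β + 1))
          (fun x hx => hx)
      have hq : Function.Surjective q :=
        e.surjective.comp ((Submodule.mkQ_surjective _).comp (by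
          rintro ⟨y, hy⟩
          obtain ⟨x, rfl⟩ := hp y
          exact ⟨⟨x, hy⟩, rfl⟩))
      have hexact : Function.Exact (Submodule.inclusion (hdβ.trans_le hle)) q := by
        rintro ⟨x, hx⟩
        have : q ⟨x, hx⟩ = 0 ↔ x ∈ g.domain := by
          rw [hdβ]
          simp only [q, LinearMap.comp_apply, LinearEquiv.coe_coe, map_eq_zero_iff e e.injective,
            Submodule.mkQ_apply, Submodule.Quotient.mk_eq_zero]
          rfl
        rw [this]
        constructor
        · intro h; exact ⟨⟨x, h⟩, rfl⟩
        · rintro ⟨⟨y, hy⟩, h⟩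
          obtain rfl : y = x := congrArg Subtype.val h
          exact hy
      obtain ⟨g', hg'⟩ := exists_extension_of_subsingleton_ext (A := g.domain) (B := G (β + 1))
        (X := X) (N := N) (hN X hX) (Submodule.inclusion (hdβ.trans_le hle)) q
        (Submodule.inclusion_injective _) hq hexact g.toFun
      have hgle : g ≤ ⟨G (β + 1), g'⟩ := by
        refine ⟨hdβ.trans_le hle, ?_⟩
        rintro ⟨x, hx⟩ ⟨y, hy⟩ rfl
        exact (LinearMap.congr_fun hg' ⟨_, hx⟩).symm
      refine hα ?_
      rw [hβs]
      exact (hmax.2 (y := ⟨G (β + 1), g'⟩) ⟨⟨β + 1, hβ1, rfl⟩, hmax.1.2.trans hgle⟩ hgle).1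
    · refine hα fun x hx => ?_
      obtain ⟨β, hβ, hxβ⟩ := hlim _ hασ hl x hx
      exact hlt β hβ hxβ
  refine ⟨g.toFun ∘ₗ (LinearMap.id.codRestrict g.domain (by simp [hdom])), ?_⟩
  ext ⟨x, hx⟩
  exact (hfg.2 (x := ⟨x, hx⟩) (y := ⟨x, by simp [hdom]⟩) rfl).symm

end

section

/-! ### Reduction of leading terms in well-ordered sums. -/

section Lattice

variable {R : Type*} [Ring R] {M : Type*} [AddCommGroup M] [Module R M]
  {I : Type*} [LinearOrder I]

/-- An element of `⨆ i ∈ S, r i` already lies in `⨆ i ∈ S ∩ Iic t, r i` for some `t ∈ S`,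
unless it is zero. -/
theorem exists_mem_biSup_Iic (r : I → Submodule R M) (S : Set I) {x : M}
    (hx : x ∈ ⨆ i ∈ S, r i) : x = 0 ∨ ∃ t ∈ S, x ∈ ⨆ i ∈ S ∩ Set.Iic t, r i := by
  have hmono : ∀ t t', t ≤ t' → (⨆ i ∈ S ∩ Set.Iic t, r i) ≤ ⨆ i ∈ S ∩ Set.Iic t', r i :=
    fun t t' h => biSup_mono fun i hi => ⟨hi.1, hi.2.trans h⟩
  refine Submodule.iSup_induction' (p := fun i => ⨆ _ : i ∈ S, r i)
    (motive := fun x _ => x = 0 ∨ ∃ t ∈ S, x ∈ ⨆ i ∈ S ∩ Set.Iic t, r i) ?_ (Or.inl rfl) ?_ hx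
  · intro i x hx
    by_cases hi : i ∈ S
    · exact Or.inr ⟨i, hi, le_biSup r (⟨hi, le_rfl⟩ : i ∈ S ∩ Set.Iic i) (by simpa [hi] using hx)⟩
    · left; simpa [hi] using hx
  · rintro x y hx hy (rfl | ⟨t, ht, hxt⟩) hy'
    · simpa using hy'
    · rcases hy' with rfl | ⟨t', ht', hyt⟩
      · right; exact ⟨t, ht, by simpa using hxt⟩
      · right
        rcases le_total t t' with h | h
        · exact ⟨t', ht', add_mem (hmono _ _ h hxt) hyt⟩
        · exact ⟨t, ht, add_mem hxt (hmono _ _ h hyt)⟩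

/-- Reduction of leading terms: if every element of `Z` with leading term in position `t ∈ S` can be
moved to smaller positions modulo `D`, then `D` contains the part of `Z` supported on `S`. -/
theorem inf_biSup_le_of_reduction [WellFoundedLT I] (r : I → Submodule R M) (S : Set I)
    (Z D : Submodule R M)
    (h : ∀ t ∈ S, Z ⊓ (⨆ i ∈ S ∩ Set.Iic t, r i) ≤ D ⊔ (Z ⊓ ⨆ i ∈ S ∩ Set.Iio t, r i)) :
    Z ⊓ (⨆ i ∈ S, r i) ≤ D := by
  have key : ∀ t ∈ S, Z ⊓ (⨆ i ∈ S ∩ Set.Iic t, r i) ≤ D := by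
    intro t
    induction t using WellFoundedLT.induction with
    | _ t ih =>
    intro ht
    refine (h t ht).trans (sup_le le_rfl ?_)
    rintro x ⟨hxZ, hx⟩
    -- The remainder is a finite sum of terms below `t`, so a single `t' < t` bounds it and the
    -- induction applies.
    rcases exists_mem_biSup_Iic r _ hx with rfl | ⟨t', ht', hxt⟩
    · exact zero_mem _
    · refine ih t' ht'.2 ht'.1 ⟨hxZ, ?_⟩
      exact (biSup_mono fun i hi => ⟨hi.1.1, hi.2⟩ :
        (⨆ i ∈ S ∩ Set.Iio t ∩ Set.Iic t', r i) ≤ _) hxt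
  rintro x ⟨hxZ, hx⟩
  rcases exists_mem_biSup_Iic r _ hx with rfl | ⟨t, ht, hxt⟩
  · exact zero_mem _
  · exact key t ht ⟨hxZ, hxt⟩

theorem biSup_inter_Iic_eq (r : I → Submodule R M) (S : Set I) {t : I} (ht : t ∈ S) :
    (⨆ i ∈ S ∩ Set.Iic t, r i) = r t ⊔ ⨆ i ∈ S ∩ Set.Iio t, r i := by
  apply le_antisymm
  · refine iSup₂_le fun i hi => ?_
    rcases (show i ≤ t from hi.2).eq_or_lt with rfl | h
    · exact le_sup_left
    · exact le_sup_of_le_right (le_biSup r (⟨hi.1, h⟩ : i ∈ S ∩ Set.Iio t))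
  · exact sup_le (le_biSup r (⟨ht, le_rfl⟩ : t ∈ S ∩ Set.Iic t))
      (biSup_mono fun i hi => ⟨hi.1, le_of_lt hi.2⟩)

end Lattice

/-! ### Presentations with κ generators and relations. -/

section Presentation

variable {R : Type u} [Ring R] {K : Type u}

theorem exists_range_span_eq {V : Type*} [AddCommGroup V] [Module R V] (S : Set V)
    (hS : Cardinal.lift.{u} (Cardinal.mk S) ≤ Cardinal.lift (Cardinal.mk K)) :
    ∃ rel : K → V, Submodule.span R (Set.range rel) = Submodule.span R S := by
  rcases isEmpty_or_nonempty S with h | h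
  · refine ⟨0, ?_⟩
    rw [Set.isEmpty_coe_sort.mp h]
    rw [Submodule.span_empty, Submodule.span_eq_bot]
    rintro _ ⟨k, rfl⟩; rfl
  · obtain ⟨⟨e, he⟩⟩ := Cardinal.lift_mk_le'.mp hS
    refine ⟨fun k => (Function.invFun e k : S), ?_⟩
    congr 1
    ext x
    constructor
    · rintro ⟨k, rfl⟩; exact Subtype.prop _
    · intro hx
      exact ⟨e ⟨x, hx⟩, by simp [Function.leftInverse_invFun he _]⟩

/-- A kernel is generated by relations known modulo an endomorphism `φ` of the free module over it,
together with the differences `x - φ x` on the basis. -/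
theorem ker_eq_span_union {ι : Type*} {M : Type*} [AddCommGroup M] [Module R M]
    (f : (ι →₀ R) →ₗ[R] M) (φ : (ι →₀ R) →ₗ[R] (ι →₀ R)) (hφ : f ∘ₗ φ = f) (S : Set (ι →₀ R))
    (h₁ : ∀ x, f x = 0 → φ x ∈ Submodule.span R S) (h₂ : ∀ x ∈ S, f x = 0) :
    Submodule.span R
      (S ∪ Set.range fun k => Finsupp.single k 1 - φ (Finsupp.single k 1)) = LinearMap.ker f := by
  apply le_antisymm
  · rw [Submodule.span_le]
    rintro x (hx | ⟨k, rfl⟩)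
    · exact h₂ x hx
    · have := LinearMap.congr_fun hφ (Finsupp.single k 1)
      simp only [LinearMap.comp_apply] at this
      simp [this]
  · intro x hx
    have h : ∀ y : ι →₀ R, y - φ y ∈ Submodule.span R
        (S ∪ Set.range fun k => Finsupp.single k 1 - φ (Finsupp.single k 1)) := by
      intro y
      induction y using Finsupp.induction_linear with
      | zero => simp
      | add a b ha hb =>
        have : a + b - φ (a + b) = (a - φ a) + (b - φ b) := by rw [map_add]; abel
        rw [this]; exact add_mem ha hb
      | single k c =>
        have : Finsupp.single k c - φ (Finsupp.single k c) =
            c • (Finsupp.single k 1 - φ (Finsupp.single k 1)) := by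
          rw [smul_sub, ← map_smul]; simp
        rw [this]
        exact Submodule.smul_mem _ _ (Submodule.subset_span (Or.inr ⟨k, rfl⟩))
    have := add_mem (h x) (Submodule.span_mono Set.subset_union_left (h₁ x hx))
    simpa using this

theorem mk_union_range_le {V ι : Type u} {κ : Cardinal.{u}} (hκ : Cardinal.aleph0 ≤ κ)
    {S : Set V} (hS : Cardinal.mk S ≤ κ) (hι : Cardinal.mk ι ≤ κ) (f : ι → V) :
    Cardinal.mk (S ∪ Set.range f : Set V) ≤ κ :=
  (Cardinal.mk_union_le _ _).trans (Cardinal.add_le_of_le hκ hS (Cardinal.mk_range_le.trans hι))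

/-- A retract of a `≤ κ`-presented module is `≤ κ`-presented. -/
theorem IsLePresented.retract {κ : Cardinal.{u}} (hκ : Cardinal.aleph0 ≤ κ)
    {M N : ModuleCat.{u} R} (hM : IsLePresented κ M) (a : N →ₗ[R] M) (b : M →ₗ[R] N)
    (hba : b ∘ₗ a = LinearMap.id) : IsLePresented κ N := by
  obtain ⟨ι, f, S, hι, hf, hS, hker⟩ := hM
  -- `φ` lifts the idempotent `a ∘ b` to the free module. Passing to the retract only adds the
  -- relations `x - φ x` on the basis.
  obtain ⟨φ, hφ⟩ := Module.projective_lifting_property f (a ∘ₗ b ∘ₗ f) hf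
  have hba' : ∀ y, b (a y) = y := LinearMap.congr_fun hba
  have hφ' : ∀ x, f (φ x) = a (b (f x)) := LinearMap.congr_fun hφ
  refine ⟨ι, b ∘ₗ f, _, hι, ?_, ?_, ker_eq_span_union (b ∘ₗ f) φ ?_ S ?_ ?_⟩
  · exact (Function.LeftInverse.surjective hba').comp hf
  · exact mk_union_range_le hκ hS hι _
  · ext x; simp [hφ', hba']
  · intro x hx
    rw [hker, LinearMap.mem_ker, hφ']
    simp [show b (f x) = 0 from hx]
  · intro x hx
    have : f x = 0 := by
      rw [← LinearMap.mem_ker, ← hker]; exact Submodule.subset_span hx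
    simp [this]

/-- A `≤ κ`-presented module is a quotient of the free module on any index set of cardinality `κ`,
with kernel generated by `κ` elements. -/
theorem IsLePresented.exists_presentation [Infinite K] {M : ModuleCat.{u} R}
    (hM : IsLePresented (Cardinal.mk K) M) :
    ∃ (f : (K →₀ R) →ₗ[R] M) (rel : K → (K →₀ R)), Function.Surjective f ∧
      Submodule.span R (Set.range rel) = LinearMap.ker f := by
  have hκ : Cardinal.aleph0 ≤ Cardinal.mk K := Cardinal.aleph0_le_mk K
  obtain ⟨ι, f₀, S, hι, hf₀, hS, hker⟩ := hM
  obtain ⟨⟨e, he⟩⟩ := hι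
  let f : (K →₀ R) →ₗ[R] M := f₀ ∘ₗ Finsupp.lcomapDomain e he
  have hf : Function.Surjective f := by
    refine hf₀.comp fun x => ⟨Finsupp.mapDomain e x, ?_⟩
    exact Finsupp.comapDomain_mapDomain e he x
  -- The two free covers are compared in both directions; `a ∘ b` then plays the role of `φ` over
  -- the identity of `M`.
  obtain ⟨a, ha⟩ := Module.projective_lifting_property f f₀ hf
  obtain ⟨b, hb⟩ := Module.projective_lifting_property f₀ f hf₀
  have ha' : ∀ x, f (a x) = f₀ x := LinearMap.congr_fun ha
  have hb' : ∀ x, f₀ (b x) = f x := LinearMap.congr_fun hb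
  have hker' := ker_eq_span_union f (a ∘ₗ b) (by ext x; simp [ha', hb']) (a '' S)
    (by
      intro x hx
      rw [← Submodule.map_span, hker]
      exact Submodule.mem_map_of_mem (by rw [LinearMap.mem_ker, hb', hx]))
    (by
      rintro _ ⟨x, hx, rfl⟩
      rw [ha', ← LinearMap.mem_ker, ← hker]; exact Submodule.subset_span hx)
  obtain ⟨rel, hrel⟩ := exists_range_span_eq (R := R) (K := K) _
    (Cardinal.lift_le.mpr (mk_union_range_le hκ (Cardinal.mk_image_le.trans hS) le_rfl
      fun k => Finsupp.single k 1 - (a ∘ₗ b) (Finsupp.single k 1)))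
  exact ⟨f, rel, hf, hrel.trans hker'⟩

end Presentation

variable {R : Type u} [Ring R]

theorem ClosedUnderDirectSummands.of_linearEquiv {A : ObjectProperty (ModuleCat.{u} R)}
    (hA : ClosedUnderDirectSummands A) {M N : ModuleCat.{u} R} (hM : A M) (e : M ≃ₗ[R] N) : A N :=
  hA M N (ModuleCat.of R PUnit) hM ⟨e.trans LinearEquiv.prodUnique.symm⟩

theorem ClosedUnderDirectSummands.retract {A : ObjectProperty (ModuleCat.{u} R)}
    (hA : ClosedUnderDirectSummands A) {M N : ModuleCat.{u} R} (hM : A M)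
    (a : N →ₗ[R] M) (b : M →ₗ[R] N) (hba : b ∘ₗ a = LinearMap.id) : A N := by
  have hba' : ∀ y, b (a y) = y := LinearMap.congr_fun hba
  refine hA M N (ModuleCat.of R (LinearMap.ker b)) hM ⟨LinearEquiv.ofBijective
    (b.prod ((LinearMap.id - a ∘ₗ b).codRestrict (LinearMap.ker b) fun x => by simp [hba']))
    ⟨?_, ?_⟩⟩
  · rw [injective_iff_map_eq_zero]
    intro x hx
    have h1 : b x = 0 := congrArg Prod.fst hx
    have h2 : x - a (b x) = 0 := congrArg (fun z : N × LinearMap.ker b => (z.2 : M)) hx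
    simpa [h1] using h2
  · rintro ⟨y, ⟨z, hz⟩⟩
    rw [LinearMap.mem_ker] at hz
    refine ⟨a y + z, ?_⟩
    ext <;> simp [hba', hz]

end

/-! ### Filtrations and block systems. -/

section

variable {R : Type u} [Ring R]

/-- The image of `V` in `W / U` is everything if `W` is the sum of `U` and the image of `V`. -/
theorem nonempty_quotient_comap_equiv {V Q : Type*} [AddCommGroup V] [Module R V]
    [AddCommGroup Q] [Module R Q] (g : V →ₗ[R] Q) (U W : Submodule R Q)
    (hW : LinearMap.range g ⊔ U = W) :
    Nonempty ((V ⧸ U.comap g) ≃ₗ[R] (W ⧸ U.submoduleOf W)) := by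
  let g' : V →ₗ[R] W := g.codRestrict W fun x => hW ▸ Submodule.mem_sup_left ⟨x, rfl⟩
  let p : V →ₗ[R] (W ⧸ U.submoduleOf W) := (U.submoduleOf W).mkQ ∘ₗ g'
  have hker : LinearMap.ker p = U.comap g := by
    ext x
    simp only [p, LinearMap.mem_ker, LinearMap.comp_apply, Submodule.mkQ_apply,
      Submodule.Quotient.mk_eq_zero]
    rfl
  have hp : Function.Surjective p := by
    intro y
    obtain ⟨⟨y, hy⟩, rfl⟩ := Submodule.mkQ_surjective _ y
    obtain ⟨_, ⟨x, rfl⟩, z, hz, rfl⟩ := Submodule.mem_sup.mp (hW ▸ hy)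
    refine ⟨x, ?_⟩
    simp only [p, LinearMap.comp_apply, Submodule.mkQ_apply]
    rw [Submodule.Quotient.eq]
    change g x - (g x + z) ∈ U
    simpa using hz
  exact ⟨(Submodule.quotEquivOfEq _ _ hker.symm).trans (p.quotKerEquivOfSurjective hp)⟩

/-- A monotone family of submodules over a well-ordered type gives a filtration. -/
theorem filtered_of_monotone {C : ObjectProperty (ModuleCat.{u} R)} {M : ModuleCat.{u} R}
    {I : Type u} [LinearOrder I] [WellFoundedLT I] (W : I → Submodule R M) (hW : Monotone W)
    (htop : ⨆ i, W i = ⊤)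
    (hC : ∀ i, ∃ N, C N ∧
      Nonempty ((W i ⧸ (⨆ j ∈ Set.Iio i, W j).submoduleOf (W i)) ≃ₗ[R] N)) :
    Filtered C M := by
  let o : I → Ordinal.{u} := Ordinal.typein (· < ·)
  have ho : ∀ {i j}, o i < o j ↔ i < j := Ordinal.typein_lt_typein _
  -- The strict inequality makes `F` continuous although `W` need not be: `F (o i)` is the supremum
  -- of the earlier `W j`, and `W i` enters at `o i + 1`.
  let F : Ordinal.{u} → Submodule R M := fun α => ⨆ i ∈ {i | o i < α}, W i
  have hF : Monotone F := fun α β h => biSup_mono fun i (hi : o i < α) => hi.trans_le h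
  refine ⟨Ordinal.type (α := I) (· < ·), F, ?_, ?_, fun α β h _ => hF h, ?_, ?_⟩
  · simp [F]
  · rw [← htop]
    exact le_antisymm (iSup₂_le fun i _ => le_iSup W i)
      (iSup_le fun i => le_biSup W (Ordinal.typein_lt_type _ i : o i < _))
  · intro α _ hα
    apply subset_antisymm
    · intro x hx
      rcases exists_mem_biSup_Iic W _ hx with rfl | ⟨t, ht, hxt⟩
      · exact Set.mem_iUnion₂.mpr ⟨0, hα.bot_lt, zero_mem _⟩
      · refine Set.mem_iUnion₂.mpr ⟨o t + 1, hα.add_one_lt ht, ?_⟩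
        refine (biSup_mono fun i hi => ?_ : (⨆ i ∈ {i | o i < α} ∩ Set.Iic t, W i) ≤ _) hxt
        have h := hi.2
        exact Order.lt_add_one_iff.mpr (show o i ≤ o t from
          le_of_not_gt fun h' => (ho.mp h').not_ge h)
    · exact Set.iUnion₂_subset fun β hβ => hF (le_of_lt hβ)
  · intro α hα
    obtain ⟨i, rfl⟩ := Ordinal.typein_surj _ hα
    have h₁ : F (o i + 1) = W i := by
      apply le_antisymm
      · refine iSup₂_le fun j hj => hW ?_
        have h : o j ≤ o i := Order.lt_add_one_iff.mp hj
        exact le_of_not_gt fun h' => (ho.mpr h').not_ge h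
      · exact le_biSup W (Order.lt_add_one_iff.mpr le_rfl : o i < o i + 1)
    have h₂ : F (o i) = ⨆ j ∈ Set.Iio i, W j := by
      simp only [F, ho]; rfl
    change ∃ N, C N ∧ Nonempty ((F (o i + 1) ⧸ (F (o i)).submoduleOf (F (o i + 1))) ≃ₗ[R] N)
    rw [h₁, h₂]
    exact hC i

section Blocks

variable (A : ObjectProperty (ModuleCat.{u} R)) {K : Type u}

/-- A well-ordered family of maps `g i` from the free module on `K` whose images generate `Q`, such
that the image of `g i` modulo the previous ones is in `A` and has `K` relations. -/
structure IsBlockSystem {I : Type u} [LinearOrder I] {Q : Type u} [AddCommGroup Q] [Module R Q]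
    (g : I → (K →₀ R) →ₗ[R] Q) : Prop where
  iSup_range : ⨆ i, LinearMap.range (g i) = ⊤
  exists_rel : ∀ i, ∃ rel : K → (K →₀ R),
    Submodule.span R (Set.range rel) = (⨆ j ∈ Set.Iio i, LinearMap.range (g j)).comap (g i)
  mem : ∀ i, A (ModuleCat.of R
    ((K →₀ R) ⧸ (⨆ j ∈ Set.Iio i, LinearMap.range (g j)).comap (g i)))

variable (K) in
/-- `Q` is generated by a block system. -/
def HasBlocks (Q : Type u) [AddCommGroup Q] [Module R Q] : Prop :=
  ∃ (I : Type u) (_ : LinearOrder I) (_ : WellFoundedLT I) (g : I → (K →₀ R) →ₗ[R] Q),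
    IsBlockSystem A g

variable {A}

theorem isLePresented_quotient_span (rel : K → (K →₀ R)) :
    IsLePresented (Cardinal.mk K)
      (ModuleCat.of R ((K →₀ R) ⧸ Submodule.span R (Set.range rel))) :=
  ⟨K, Submodule.mkQ _, Set.range rel, le_rfl, Submodule.mkQ_surjective _, Cardinal.mk_range_le,
    (Submodule.ker_mkQ _).symm⟩

theorem IsBlockSystem.lePresented {I : Type u} [LinearOrder I] {Q : Type u} [AddCommGroup Q]
    [Module R Q] {g : I → (K →₀ R) →ₗ[R] Q} (hg : IsBlockSystem A g) (i : I) :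
    lePresented A (Cardinal.mk K) (ModuleCat.of R
      ((K →₀ R) ⧸ (⨆ j ∈ Set.Iio i, LinearMap.range (g j)).comap (g i))) := by
  refine ⟨hg.mem i, ?_⟩
  obtain ⟨rel, hrel⟩ := hg.exists_rel i
  rw [← hrel]
  exact isLePresented_quotient_span rel

theorem HasBlocks.restricted {Q : Type u} [AddCommGroup Q] [Module R Q] (hQ : HasBlocks A K Q) :
    restricted A (Cardinal.mk K) (ModuleCat.of R Q) := by
  obtain ⟨I, _, _, g, hg⟩ := hQ
  let r : I → Submodule R Q := fun i => LinearMap.range (g i)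
  have hlt : ∀ i, (⨆ j ∈ Set.Iio i, ⨆ k ∈ Set.Iic j, r k) = ⨆ j ∈ Set.Iio i, r j := fun i =>
    le_antisymm (iSup₂_le fun j hj => biSup_mono fun k hk => lt_of_le_of_lt hk hj)
      (iSup₂_mono fun j _ => le_biSup r (le_refl j))
  refine filtered_of_monotone (I := I) (M := ModuleCat.of R Q) (fun i => ⨆ j ∈ Set.Iic i, r j)
    (fun i j h => biSup_mono fun k hk => le_trans hk h) ?_ ?_
  · refine top_le_iff.mp (hg.iSup_range.symm.le.trans ?_)
    exact iSup_mono fun i => le_biSup r (le_refl i)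
  · intro i
    refine ⟨_, hg.lePresented i, ?_⟩
    rw [hlt]
    obtain ⟨e⟩ := nonempty_quotient_comap_equiv (g i) (⨆ j ∈ Set.Iio i, r j)
      (⨆ j ∈ Set.Iic i, r j) (by
        have := biSup_inter_Iic_eq r Set.univ (Set.mem_univ i)
        simp only [Set.univ_inter] at this
        exact this.symm)
    exact ⟨e.symm⟩

/-- A module with a block system of at most `κ` blocks is `≤ κ`-presented. -/
theorem IsBlockSystem.isLePresented [Infinite K] {I : Type u} [LinearOrder I] [WellFoundedLT I]
    {Q : Type u} [AddCommGroup Q] [Module R Q] {g : I → (K →₀ R) →ₗ[R] Q} (hg : IsBlockSystem A g)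
    (hI : Cardinal.mk I ≤ Cardinal.mk K) : IsLePresented (Cardinal.mk K) (ModuleCat.of R Q) := by
  have hκ : Cardinal.aleph0 ≤ Cardinal.mk K := Cardinal.aleph0_le_mk K
  have hIK : Cardinal.mk (I × K) ≤ Cardinal.mk K := by
    rw [Cardinal.mk_prod, Cardinal.lift_id, Cardinal.lift_id]
    exact Cardinal.mul_le_of_le hκ hI le_rfl
  choose rel hrel using hg.exists_rel
  let ι : I → (K →₀ R) →ₗ[R] (I × K →₀ R) := fun i => Finsupp.lmapDomain R R (Prod.mk i)
  let f : (I × K →₀ R) →ₗ[R] Q :=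
    Finsupp.linearCombination R fun p => g p.1 (Finsupp.single p.2 1)
  have hfι : ∀ i x, f (ι i x) = g i x := by
    intro i
    have : f ∘ₗ ι i = g i := by ext k; simp [f, ι]
    exact LinearMap.congr_fun this
  let r : I → Submodule R (I × K →₀ R) := fun i => LinearMap.range (ι i)
  have hmap : ∀ i, (r i).map f = LinearMap.range (g i) := by
    intro i
    rw [← LinearMap.range_comp]
    exact congrArg _ (LinearMap.ext (hfι i))
  have htop : ⨆ i ∈ Set.univ, r i = ⊤ := by
    rw [eq_top_iff]
    intro x _
    induction x using Finsupp.induction_linear with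
    | zero => exact zero_mem _
    | add a b ha hb => exact add_mem (ha trivial) (hb trivial)
    | single p c =>
      exact (le_biSup r (Set.mem_univ p.1)) ⟨Finsupp.single p.2 c, by simp [ι]⟩
  have hsurj : Function.Surjective f := by
    rw [← LinearMap.range_eq_top, LinearMap.range_eq_map, ← htop, ← hg.iSup_range]
    simp only [Set.mem_univ, iSup_pos, Submodule.map_iSup, hmap]
  -- A relation of block `i` holds only modulo earlier images; `y` lifts the correction to the
  -- earlier part of the big free module.
  have hy : ∀ p : I × K, ∃ y ∈ ⨆ j ∈ Set.Iio p.1, r j, f y = g p.1 (rel p.1 p.2) := by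
    rintro ⟨i, k⟩
    have h1 : rel i k ∈ (⨆ j ∈ Set.Iio i, LinearMap.range (g j)).comap (g i) := by
      rw [← hrel i]; exact Submodule.subset_span ⟨k, rfl⟩
    rw [Submodule.mem_comap] at h1
    simp only [← hmap, ← Submodule.map_iSup] at h1
    exact h1
  choose y hylt hyf using hy
  let s : I × K → (I × K →₀ R) := fun p => ι p.1 (rel p.1 p.2) - y p
  refine ⟨I × K, f, Set.range s, hIK, hsurj, Cardinal.mk_range_le.trans hIK, le_antisymm ?_ ?_⟩
  · rw [Submodule.span_le]
    rintro _ ⟨p, rfl⟩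
    simp [s, hfι, hyf]
  -- The leading coefficient of an element of `ker f` is a relation of its block, so subtracting
  -- corrected relations `s` lowers the leading position.
  · have := inf_biSup_le_of_reduction r Set.univ (LinearMap.ker f)
      (Submodule.span R (Set.range s)) ?_
    · rwa [htop, inf_top_eq] at this
    intro t _
    rw [biSup_inter_Iic_eq r _ (Set.mem_univ t)]
    simp only [Set.univ_inter]
    rintro e ⟨hez, he⟩
    obtain ⟨_, ⟨x, rfl⟩, b, hb, rfl⟩ := Submodule.mem_sup.mp he
    have hfb : f b ∈ ⨆ j ∈ Set.Iio t, LinearMap.range (g j) := by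
      simp only [← hmap, ← Submodule.map_iSup]
      exact Submodule.mem_map_of_mem hb
    have hx : x ∈ Submodule.span R (Set.range (rel t)) := by
      rw [hrel, Submodule.mem_comap, ← hfι]
      have : f (ι t x) = - f b := by
        rw [eq_neg_iff_add_eq_zero, ← map_add]; exact hez
      rw [this]
      exact neg_mem hfb
    have hd : ∃ d ∈ Submodule.span R (Set.range s),
        ι t x - d ∈ ⨆ j ∈ Set.Iio t, r j := by
      clear he hez
      induction hx using Submodule.span_induction with
      | mem x hx =>
        obtain ⟨k, rfl⟩ := hx
        exact ⟨s (t, k), Submodule.subset_span ⟨_, rfl⟩, by simpa [s] using hylt (t, k)⟩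
      | zero => exact ⟨0, zero_mem _, by simp⟩
      | add a b _ _ ha hb =>
        obtain ⟨d, hd, hd'⟩ := ha
        obtain ⟨d₂, hd₂, hd₂'⟩ := hb
        refine ⟨d + d₂, add_mem hd hd₂, ?_⟩
        rw [map_add, add_sub_add_comm]
        exact add_mem hd' hd₂'
      | smul c a _ ha =>
        obtain ⟨d, hd, hd'⟩ := ha
        refine ⟨c • d, Submodule.smul_mem _ _ hd, ?_⟩
        rw [map_smul, ← smul_sub]
        exact Submodule.smul_mem _ _ hd'
    obtain ⟨d, hd, hd'⟩ := hd
    have hfd : Submodule.span R (Set.range s) ≤ LinearMap.ker f := by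
      rw [Submodule.span_le]
      rintro _ ⟨p, rfl⟩
      simp [s, hfι, hyf]
    refine Submodule.mem_sup.mpr ⟨d, hd, ι t x + b - d, ⟨?_, ?_⟩, by abel⟩
    · exact sub_mem hez (hfd hd)
    · rw [add_sub_right_comm]; exact add_mem hd' hb

end Blocks

end

section

variable {R : Type u} [Ring R]

/-! ### Block systems of free modules and of extensions. -/

section Constructions

variable {A : ObjectProperty (ModuleCat.{u} R)} {K : Type u}

/-- A free module has a block system if `R` belongs to `A`. -/
theorem hasBlocks_finsupp [Nonempty K] (hA : ClosedUnderDirectSummands A)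
    (hR : A (ModuleCat.of R R)) (X : Type u) : HasBlocks A K (X →₀ R) := by
  classical
  obtain ⟨k₀⟩ := ‹Nonempty K›
  obtain ⟨_, _⟩ := exists_wellFoundedLT X
  -- Each block is one copy of `R`, presented on `K` by killing every basis vector except the one at
  -- `k₀`.
  let g : X → (K →₀ R) →ₗ[R] (X →₀ R) := fun x => Finsupp.lsingle x ∘ₗ Finsupp.lapply k₀
  have hcomap : ∀ x, (⨆ j ∈ Set.Iio x, LinearMap.range (g j)).comap (g x) =
      LinearMap.ker (Finsupp.lapply k₀ : (K →₀ R) →ₗ[R] R) := by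
    intro x
    apply le_antisymm
    · have h1 : (⨆ j ∈ Set.Iio x, LinearMap.range (g j)) ≤
          LinearMap.ker (Finsupp.lapply x : (X →₀ R) →ₗ[R] R) := by
        refine iSup₂_le fun j (hj : j < x) => ?_
        rintro _ ⟨v, rfl⟩
        simp [g, hj.ne]
      intro v hv
      have := h1 hv
      simpa [g] using this
    · intro v hv
      have h2 : v k₀ = 0 := hv
      simp [g, h2]
  refine ⟨X, inferInstance, inferInstance, g, ?_, ?_, ?_⟩
  · rw [eq_top_iff]
    intro v _
    induction v using Finsupp.induction_linear with
    | zero => exact zero_mem _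
    | add a b ha hb => exact add_mem (ha trivial) (hb trivial)
    | single x c =>
      exact Submodule.mem_iSup_of_mem x ⟨Finsupp.single k₀ c, by simp [g]⟩
  · intro x
    rw [hcomap]
    refine ⟨fun k => if k = k₀ then 0 else Finsupp.single k 1, le_antisymm ?_ ?_⟩
    · rw [Submodule.span_le]
      rintro _ ⟨k, rfl⟩
      by_cases hk : k = k₀ <;> simp [hk]
    · intro v hv
      have h2 : v k₀ = 0 := hv
      rw [← Finsupp.sum_single v]
      refine Submodule.sum_mem _ fun k hk => ?_
      have hk' : k ≠ k₀ := by rintro rfl; exact (Finsupp.mem_support_iff.mp hk) h2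
      have h3 : Finsupp.single k (v k) = v k • (Finsupp.single k 1 : K →₀ R) := by simp
      rw [h3]
      exact Submodule.smul_mem _ _ (Submodule.subset_span ⟨k, by simp [hk']⟩)
  · intro x
    rw [hcomap]
    exact hA.of_linearEquiv hR (LinearMap.quotKerEquivOfSurjective _ fun c =>
      ⟨Finsupp.single k₀ c, by simp⟩).symm

/-- An extension of modules with block systems has a block system. -/
theorem HasBlocks.extension {P Q S : Type u} [AddCommGroup P] [AddCommGroup Q] [AddCommGroup S]
    [Module R P] [Module R Q] [Module R S] (hP : HasBlocks A K P) (hS : HasBlocks A K S)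
    (u : P →ₗ[R] Q) (v : Q →ₗ[R] S) (hu : Function.Injective u) (hv : Function.Surjective v)
    (huv : Function.Exact u v) : HasBlocks A K Q := by
  obtain ⟨I₁, _, _, g₁, hg₁⟩ := hP
  obtain ⟨I₂, _, _, g₂, hg₂⟩ := hS
  choose l hl using fun i => Module.projective_lifting_property v (g₂ i) hv
  -- The blocks of `P` come first, followed by lifts of the blocks of `S`.
  let g : I₁ ⊕ₗ I₂ → (K →₀ R) →ₗ[R] Q := fun s => Sum.elim (fun i => u ∘ₗ g₁ i) l (ofLex s)
  have hinl : ∀ i, (⨆ j ∈ Set.Iio (toLex (Sum.inl i) : I₁ ⊕ₗ I₂), LinearMap.range (g j)) =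
      (⨆ j ∈ Set.Iio i, LinearMap.range (g₁ j)).map u := by
    intro i
    simp only [Submodule.map_iSup, ← LinearMap.range_comp]
    apply le_antisymm
    · refine iSup₂_le fun s hs => ?_
      obtain ⟨s, rfl⟩ := toLex.surjective s
      rcases s with j | j
      · exact le_biSup (fun j => LinearMap.range (u ∘ₗ g₁ j)) (Sum.Lex.inl_lt_inl_iff.mp hs)
      · exact (Sum.Lex.not_inr_lt_inl hs).elim
    · refine iSup₂_le fun j hj => ?_
      exact le_biSup (fun s => LinearMap.range (g s))
        (Set.mem_Iio.mpr (Sum.Lex.inl_lt_inl_iff.mpr hj) : toLex (Sum.inl j) ∈ Set.Iio (toLex (Sum.inl i)))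
  have hker : LinearMap.ker v = (⨆ j, LinearMap.range (g₁ j)).map u := by
    rw [hg₁.iSup_range, Submodule.map_top]
    exact LinearMap.exact_iff.mp huv
  have hmapl : ∀ i, (LinearMap.range (l i)).map v = LinearMap.range (g₂ i) := fun i => by
    rw [← LinearMap.range_comp, hl]
  have hsup : ∀ T : Set I₂, LinearMap.ker v ⊔ (⨆ j ∈ T, LinearMap.range (l j)) =
      (⨆ j ∈ T, LinearMap.range (g₂ j)).comap v := by
    intro T
    simp only [← hmapl, ← Submodule.map_iSup]
    rw [Submodule.comap_map_eq, sup_comm]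
  have hkerle : ∀ j, LinearMap.range (g (toLex (Sum.inl j))) ≤ LinearMap.ker v := by
    intro j
    rw [hker, Submodule.map_iSup]
    refine le_trans (le_of_eq ?_) (le_iSup _ j)
    exact LinearMap.range_comp _ _
  -- All of `ker v` precedes a lifted block, so its relations do not depend on the chosen lift.
  have hinr : ∀ i, (⨆ j ∈ Set.Iio (toLex (Sum.inr i) : I₁ ⊕ₗ I₂), LinearMap.range (g j)) =
      (⨆ j ∈ Set.Iio i, LinearMap.range (g₂ j)).comap v := by
    intro i
    rw [← hsup]
    apply le_antisymm
    · refine iSup₂_le fun s hs => ?_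
      obtain ⟨s, rfl⟩ := toLex.surjective s
      rcases s with j | j
      · exact le_sup_of_le_left (hkerle j)
      · exact le_sup_of_le_right
          (le_biSup (fun j => LinearMap.range (l j)) (Sum.Lex.inr_lt_inr_iff.mp hs))
    · refine sup_le ?_ (iSup₂_le fun j hj => ?_)
      · rw [hker, Submodule.map_iSup]
        refine iSup_le fun j => ?_
        rw [← LinearMap.range_comp]
        exact le_biSup (fun s => LinearMap.range (g s))
          (Set.mem_Iio.mpr (Sum.Lex.inl_lt_inr j i) : toLex (Sum.inl j) ∈ Set.Iio (toLex (Sum.inr i)))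
      · exact le_biSup (fun s => LinearMap.range (g s))
          (Set.mem_Iio.mpr (Sum.Lex.inr_lt_inr_iff.mpr hj) : toLex (Sum.inr j) ∈ Set.Iio (toLex (Sum.inr i)))
  have hcinl : ∀ i, (⨆ j ∈ Set.Iio (toLex (Sum.inl i) : I₁ ⊕ₗ I₂), LinearMap.range (g j)).comap
      (g (toLex (Sum.inl i))) = (⨆ j ∈ Set.Iio i, LinearMap.range (g₁ j)).comap (g₁ i) := by
    intro i
    rw [hinl]
    change Submodule.comap (u ∘ₗ g₁ i) _ = _
    rw [Submodule.comap_comp, Submodule.comap_map_eq_of_injective hu]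
  have hcinr : ∀ i, (⨆ j ∈ Set.Iio (toLex (Sum.inr i) : I₁ ⊕ₗ I₂), LinearMap.range (g j)).comap
      (g (toLex (Sum.inr i))) = (⨆ j ∈ Set.Iio i, LinearMap.range (g₂ j)).comap (g₂ i) := by
    intro i
    rw [hinr]
    change Submodule.comap (l i) _ = _
    rw [← Submodule.comap_comp, hl]
  refine ⟨I₁ ⊕ₗ I₂, inferInstance,
    ⟨Sum.lex_wf (wellFounded_lt (α := I₁)) (wellFounded_lt (α := I₂))⟩, g, ?_, ?_, ?_⟩
  · have h := hsup Set.univ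
    simp only [Set.mem_univ, iSup_pos, hg₂.iSup_range, Submodule.comap_top] at h
    rw [eq_top_iff, ← h]
    refine sup_le ?_ (iSup_le fun j => le_iSup (fun s => LinearMap.range (g s)) (toLex (Sum.inr j)))
    rw [hker, Submodule.map_iSup]
    refine iSup_le fun j => ?_
    rw [← LinearMap.range_comp]
    exact le_iSup (fun s => LinearMap.range (g s)) (toLex (Sum.inl j))
  · intro s
    obtain ⟨s, rfl⟩ := toLex.surjective s
    rcases s with i | i
    · rw [hcinl]; exact hg₁.exists_rel i
    · rw [hcinr]; exact hg₂.exists_rel i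
  · intro s
    obtain ⟨s, rfl⟩ := toLex.surjective s
    rcases s with i | i
    · rw [hcinl]; exact hg₁.mem i
    · rw [hcinr]; exact hg₂.mem i

end Constructions

/-! ### Hill closed sets of blocks. -/

section Hill

/-- Every point is contained in a small set closed under a family of operations. -/
theorem exists_closed_set {I Q : Type u} [Infinite Q] (d : I → Q → I) (i : I) :
    ∃ T : Set I, i ∈ T ∧ (∀ j ∈ T, ∀ q, d j q ∈ T) ∧ Cardinal.mk T ≤ Cardinal.mk Q := by
  -- The closure of `i` is its orbit under finite words in the operations, and there are only `|Q|`
  -- words.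
  refine ⟨Set.range fun l : List Q => l.foldl d i, ⟨[], rfl⟩, ?_, ?_⟩
  · rintro _ ⟨l, rfl⟩ q
    exact ⟨l ++ [q], by simp⟩
  · exact Cardinal.mk_range_le.trans (Cardinal.mk_list_eq_mk Q).le

variable {M : Type*} [AddCommGroup M] [Module R M] {I : Type u}

/-- The finite support is listed as a sequence, with repetitions, so that the closure operations of
all blocks share one index set; `i₀` keeps the list nonempty. -/
theorem exists_sequence_mem_biSup (r : I → Submodule R M) (S : Set I) {x : M}
    (hx : x ∈ ⨆ i ∈ S, r i) (i₀ : I) :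
    ∃ e : ℕ → I, x ∈ ⨆ i ∈ S ∩ Set.range e, r i := by
  obtain ⟨s, hs⟩ := Submodule.mem_iSup_iff_exists_finset.mp hx
  obtain ⟨e, he⟩ := (Set.to_countable (insert i₀ (s : Set I))).exists_eq_range ⟨i₀, by simp⟩
  refine ⟨e, ?_⟩
  refine (iSup₂_le fun i hi => iSup_le fun hiS => ?_ :
    (⨆ i ∈ s, ⨆ _ : i ∈ S, r i) ≤ ⨆ i ∈ S ∩ Set.range e, r i) hs
  exact le_biSup r (⟨hiS, he ▸ Set.mem_insert_of_mem _ hi⟩ : i ∈ S ∩ Set.range e)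

variable [LinearOrder I] {K : Type u}

/-- `T` contains, with each `i`, what is needed to express the relations of the block `i`. -/
def IsHillClosed (g : I → (K →₀ R) →ₗ[R] M) (rel : I → K → (K →₀ R)) (T : Set I) : Prop :=
  ∀ i ∈ T, ∀ k, g i (rel i k) ∈ ⨆ j ∈ T ∩ Set.Iio i, LinearMap.range (g j)

variable {g : I → (K →₀ R) →ₗ[R] M} {rel : I → K → (K →₀ R)}

theorem IsHillClosed.map_span_le {T : Set I} (hT : IsHillClosed g rel T) {i : I} (hi : i ∈ T)
    {x : K →₀ R} (hx : x ∈ Submodule.span R (Set.range (rel i))) :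
    g i x ∈ ⨆ j ∈ T ∩ Set.Iio i, LinearMap.range (g j) := by
  rw [← Submodule.mem_comap]
  revert x
  change Submodule.span R (Set.range (rel i)) ≤ _
  rw [Submodule.span_le]
  rintro _ ⟨k, rfl⟩
  exact hT i hi k

/-- If an element of stage `i` has its leading term at a later `t ∈ T`, then the coefficient of that
term is a relation of block `t`. Closedness rewrites the term through earlier blocks of `T`, and the
position drops. -/
theorem IsHillClosed.inf_le [WellFoundedLT I] {T : Set I} (hT : IsHillClosed g rel T)
    (hrel : ∀ i, Submodule.span R (Set.range (rel i)) =
      (⨆ j ∈ Set.Iio i, LinearMap.range (g j)).comap (g i)) (i : I) :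
    (⨆ j ∈ Set.Iic i, LinearMap.range (g j)) ⊓ (⨆ j ∈ T, LinearMap.range (g j)) ≤
      ⨆ j ∈ T ∩ Set.Iic i, LinearMap.range (g j) := by
  refine inf_biSup_le_of_reduction (fun j => LinearMap.range (g j)) T _ _ fun t ht => ?_
  rcases le_or_gt t i with hti | hti
  · refine le_sup_of_le_left (inf_le_right.trans ?_)
    exact biSup_mono fun j hj => ⟨hj.1, le_trans hj.2 hti⟩
  · refine le_sup_of_le_right (le_inf inf_le_left ?_)
    rintro e ⟨heZ, he⟩
    rw [biSup_inter_Iic_eq _ _ ht] at he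
    obtain ⟨_, ⟨x, rfl⟩, b, hb, rfl⟩ := Submodule.mem_sup.mp he
    refine add_mem (hT.map_span_le ht ?_) hb
    rw [hrel, Submodule.mem_comap]
    have h1 : (⨆ j ∈ Set.Iic i, LinearMap.range (g j)) ≤ ⨆ j ∈ Set.Iio t, LinearMap.range (g j) :=
      biSup_mono fun j hj => lt_of_le_of_lt hj hti
    have h2 : (⨆ j ∈ T ∩ Set.Iio t, LinearMap.range (g j)) ≤
        ⨆ j ∈ Set.Iio t, LinearMap.range (g j) := biSup_mono fun j hj => hj.2
    simpa using sub_mem (h1 heZ) (h2 hb)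

end Hill

end

/-! ### Summands of modules with block systems. -/

section

variable {R : Type u} [Ring R] {A : ObjectProperty (ModuleCat.{u} R)} {K : Type u}

theorem Filtered.mono {C C' : ObjectProperty (ModuleCat.{u} R)} (h : ∀ N, C N → C' N)
    {M : ModuleCat.{u} R} (hM : Filtered C M) : Filtered C' M := by
  obtain ⟨σ, F, hF⟩ := hM
  refine ⟨σ, F, hF.zero, hF.top, hF.mono, hF.limit, fun α hα => ?_⟩
  obtain ⟨N, hN, e⟩ := hF.factor α hα
  exact ⟨N, h N hN, e⟩

/-- Factors of Hill closed sets of blocks have block systems. -/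
theorem IsHillClosed.isBlockSystem {P : Type u} [AddCommGroup P] [Module R P] {I : Type u}
    [LinearOrder I] [WellFoundedLT I] {g : I → (K →₀ R) →ₗ[R] P} {rel : I → K → (K →₀ R)}
    (hg : IsBlockSystem A g)
    (hrel : ∀ i, Submodule.span R (Set.range (rel i)) =
      (⨆ j ∈ Set.Iio i, LinearMap.range (g j)).comap (g i))
    {T T' : Set I} (hT : IsHillClosed g rel T) (hT' : IsHillClosed g rel T') (hTT' : T ⊆ T')
    (U W : Submodule R P) (hU : U = ⨆ i ∈ T, LinearMap.range (g i))
    (hW : W = ⨆ i ∈ T', LinearMap.range (g i)) :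
    ∃ h : (T' \ T : Set I) → (K →₀ R) →ₗ[R] (W ⧸ U.submoduleOf W), IsBlockSystem A h := by
  have hgW : ∀ i ∈ T', ∀ x, g i x ∈ W := fun i hi x =>
    hW ▸ le_biSup (fun j => LinearMap.range (g j)) hi ⟨x, rfl⟩
  let c : (T' \ T : Set I) → (K →₀ R) →ₗ[R] W := fun i =>
    (g i).codRestrict W (hgW i i.2.1)
  let ψ := (U.submoduleOf W).mkQ
  have hmem : ∀ (J : Set (T' \ T : Set I)) (w : W),
      ψ w ∈ (⨆ j ∈ J, LinearMap.range (ψ ∘ₗ c j)) ↔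
        (w : P) ∈ (⨆ j ∈ J, LinearMap.range (g j)) ⊔ U := by
    intro J w
    have h1 : (⨆ j ∈ J, LinearMap.range (ψ ∘ₗ c j)) = (⨆ j ∈ J, LinearMap.range (c j)).map ψ := by
      simp only [Submodule.map_iSup, ← LinearMap.range_comp]
    have h2 : (⨆ j ∈ J, LinearMap.range (g j)) =
        (⨆ j ∈ J, LinearMap.range (c j)).map W.subtype := by
      simp only [Submodule.map_iSup, ← LinearMap.range_comp]
      rfl
    have hUW : U ≤ W := by
      rw [hU, hW]; exact biSup_mono hTT'
    have h3 : U = (U.submoduleOf W).map W.subtype := by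
      rw [Submodule.submoduleOf, Submodule.map_comap_subtype, inf_eq_right.mpr hUW]
    rw [h1, ← Submodule.mem_comap, Submodule.comap_map_eq, Submodule.ker_mkQ, h2]
    conv_rhs => rw [h3, ← Submodule.map_sup]
    constructor
    · intro h; exact Submodule.mem_map_of_mem h
    · rintro ⟨y, hy, hyw⟩
      rwa [← Subtype.ext hyw]
  -- A block outside `T` keeps exactly its old relations in `W / U`.
  have hcomap : ∀ i : (T' \ T : Set I), (⨆ j ∈ Set.Iio i, LinearMap.range (ψ ∘ₗ c j)).comap (ψ ∘ₗ c i)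
      = (⨆ j ∈ Set.Iio i.1, LinearMap.range (g j)).comap (g i) := by
    intro i
    ext x
    rw [Submodule.mem_comap, LinearMap.comp_apply, hmem]
    change g i x ∈ (⨆ j ∈ Set.Iio i, LinearMap.range (g j)) ⊔ U ↔
      g i x ∈ ⨆ j ∈ Set.Iio i.1, LinearMap.range (g j)
    constructor
    · intro hx
      -- Cutting this closed set at `i` leaves only positions below `i`, because `i ∉ T`.
      have hS : IsHillClosed g rel (T ∪ (T' ∩ Set.Iio i.1)) := by
        rintro j (hj | ⟨hj, hji⟩) k
        · exact (biSup_mono fun l hl => ⟨Or.inl hl.1, hl.2⟩ :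
            (⨆ l ∈ T ∩ Set.Iio j, LinearMap.range (g l)) ≤ _) (hT j hj k)
        · exact (biSup_mono fun l hl => ⟨Or.inr ⟨hl.1, lt_trans hl.2 hji⟩, hl.2⟩ :
            (⨆ l ∈ T' ∩ Set.Iio j, LinearMap.range (g l)) ≤ _) (hT' j hj k)
      have hle : (⨆ j ∈ Set.Iio i, LinearMap.range (g j)) ⊔ U ≤
          ⨆ j ∈ T ∪ (T' ∩ Set.Iio i.1), LinearMap.range (g j) := by
        refine sup_le (iSup₂_le fun j hj => ?_) (hU.trans_le (biSup_mono fun j hj => Or.inl hj))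
        exact le_biSup (fun j => LinearMap.range (g j))
          (Or.inr ⟨j.2.1, hj⟩ : j.1 ∈ T ∪ (T' ∩ Set.Iio i.1))
      have h1 := hS.inf_le hrel i.1
        ⟨le_biSup (fun j => LinearMap.range (g j)) (Set.self_mem_Iic (a := i.1)) ⟨x, rfl⟩, hle hx⟩
      refine (biSup_mono fun j hj => ?_ : (⨆ j ∈ (T ∪ (T' ∩ Set.Iio i.1)) ∩ Set.Iic i.1,
        LinearMap.range (g j)) ≤ _) h1
      rcases hj with ⟨hj | hj, hji⟩
      · refine lt_of_le_of_ne hji ?_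
        rintro rfl
        exact i.2.2 hj
      · exact hj.2
    · intro hx
      rw [← Submodule.mem_comap, ← hrel] at hx
      refine (iSup₂_le fun j hj => ?_ : (⨆ j ∈ T' ∩ Set.Iio i.1, LinearMap.range (g j)) ≤ _)
        (hT'.map_span_le i.2.1 hx)
      by_cases hjT : j ∈ T
      · refine le_sup_of_le_right ?_
        rw [hU]
        exact le_biSup (fun j => LinearMap.range (g j)) hjT
      · refine le_sup_of_le_left ?_
        exact le_biSup (fun j : (T' \ T : Set I) => LinearMap.range (g j))
          (show (⟨j, hj.1, hjT⟩ : (T' \ T : Set I)) ∈ Set.Iio i from hj.2)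
  refine ⟨fun i => ψ ∘ₗ c i, ?_, ?_, ?_⟩
  · rw [eq_top_iff]
    intro y _
    obtain ⟨w, rfl⟩ := Submodule.mkQ_surjective _ y
    have h1 := (hmem Set.univ w).mpr (by
      refine (hW.trans_le (iSup₂_le fun j hj => ?_)) w.2
      by_cases hjT : j ∈ T
      · refine le_sup_of_le_right ?_
        rw [hU]
        exact le_biSup (fun j => LinearMap.range (g j)) hjT
      · refine le_sup_of_le_left ?_
        exact le_biSup (fun j : (T' \ T : Set I) => LinearMap.range (g j))
          (Set.mem_univ (⟨j, hj, hjT⟩ : (T' \ T : Set I))))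
    simpa only [Set.mem_univ, iSup_pos] using h1
  · intro i
    rw [hcomap]
    exact ⟨_, hrel i.1⟩
  · intro i
    rw [hcomap]
    exact hg.mem i.1

/-- Retractions restrict to factors of stable submodules. -/
theorem exists_retract_quotient {P X : Type*} [AddCommGroup P] [Module R P] [AddCommGroup X]
    [Module R X] (a : X →ₗ[R] P) (b : P →ₗ[R] X) (hba : b ∘ₗ a = LinearMap.id)
    (U W : Submodule R P) (hU : U ≤ U.comap (a ∘ₗ b)) (hW : W ≤ W.comap (a ∘ₗ b)) :
    ∃ (a' : (W.map b ⧸ (U.map b).submoduleOf (W.map b)) →ₗ[R] (W ⧸ U.submoduleOf W))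
      (b' : (W ⧸ U.submoduleOf W) →ₗ[R] (W.map b ⧸ (U.map b).submoduleOf (W.map b))),
      b' ∘ₗ a' = LinearMap.id := by
  have hba' : ∀ x, b (a x) = x := LinearMap.congr_fun hba
  let a₀ : W.map b →ₗ[R] W := a.restrict (by rintro _ ⟨w, hw, rfl⟩; exact hW hw)
  let b₀ : W →ₗ[R] W.map b := b.restrict fun w hw => Submodule.mem_map_of_mem hw
  refine ⟨Submodule.mapQ _ _ a₀ ?_, Submodule.mapQ _ _ b₀ ?_, ?_⟩
  · rintro ⟨x, hx⟩ ⟨w, hw, rfl⟩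
    exact hU hw
  · rintro ⟨w, hw⟩ hwU
    exact Submodule.mem_map_of_mem (show w ∈ U from hwU)
  · ext x
    change Submodule.Quotient.mk (b₀ (a₀ x)) = Submodule.Quotient.mk x
    congr 1
    exact Subtype.ext (hba' x)

/-- A direct summand of a module with a block system is filtered by `≤ κ`-presented members of
`A`. -/
theorem HasBlocks.restricted_of_retract [Infinite K] (hfilt : ClosedUnderTransfiniteExtensions A)
    (hsumm : ClosedUnderDirectSummands A) {P X : Type u} [AddCommGroup P] [Module R P]
    [AddCommGroup X] [Module R X] (hP : HasBlocks A K P) (a : X →ₗ[R] P) (b : P →ₗ[R] X)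
    (hba : b ∘ₗ a = LinearMap.id) : ModClass.restricted A (Cardinal.mk K) (ModuleCat.of R X) := by
  obtain ⟨I, _, _, g, hg⟩ := hP
  have hba' : ∀ x, b (a x) = x := LinearMap.congr_fun hba
  choose rel hrel using hg.exists_rel
  let r : I → Submodule R P := fun i => LinearMap.range (g i)
  have h₁ : ∀ i k, ∃ e : ℕ → I, g i (rel i k) ∈ ⨆ j ∈ Set.Iio i ∩ Set.range e, r j := by
    intro i k
    refine exists_sequence_mem_biSup r _ ?_ i
    change rel i k ∈ (⨆ j ∈ Set.Iio i, LinearMap.range (g j)).comap (g i)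
    rw [← hrel]
    exact Submodule.subset_span ⟨k, rfl⟩
  have h₂ : ∀ i k, ∃ e : ℕ → I,
      a (b (g i (Finsupp.single k 1))) ∈ ⨆ j ∈ Set.univ ∩ Set.range e, r j := by
    intro i k
    refine exists_sequence_mem_biSup r _ ?_ i
    simp [r, hg.iSup_range]
  choose e₁ he₁ using h₁
  choose e₂ he₂ using h₂
  -- Closure under the `true` operations gives Hill closedness; closure under the `false` ones gives
  -- stability under `a ∘ b`.
  let d : I → Bool × K × ℕ → I := fun i q => if q.1 then e₁ i q.2.1 q.2.2 else e₂ i q.2.1 q.2.2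
  let Stable : Set I → Prop := fun T => ∀ j ∈ T, ∀ q, d j q ∈ T
  have hstable : ∀ {ι : Type u} (s : ι → Set I), (∀ i, Stable (s i)) → Stable (⋃ i, s i) := by
    intro ι s hs j hj q
    obtain ⟨i, hi⟩ := Set.mem_iUnion.mp hj
    exact Set.mem_iUnion.mpr ⟨i, hs i j hi q⟩
  have hhill : ∀ T, Stable T → IsHillClosed g rel T := by
    intro T hT i hi k
    refine (biSup_mono ?_ : (⨆ j ∈ Set.Iio i ∩ Set.range (e₁ i k), r j) ≤ _) (he₁ i k)
    rintro _ ⟨hj, n, rfl⟩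
    exact ⟨by simpa [d] using hT i hi (true, k, n), hj⟩
  have hπ : ∀ T, Stable T → (⨆ i ∈ T, r i) ≤ (⨆ i ∈ T, r i).comap (a ∘ₗ b) := by
    intro T hT
    refine iSup₂_le fun i hi => ?_
    rintro _ ⟨x, rfl⟩
    rw [← Submodule.mem_comap]
    induction x using Finsupp.induction_linear with
    | zero => exact zero_mem _
    | add x y hx hy => exact add_mem hx hy
    | single k c =>
      rw [show Finsupp.single k c = c • (Finsupp.single k 1 : K →₀ R) by simp]
      refine Submodule.smul_mem _ _ ?_
      refine (biSup_mono ?_ : (⨆ j ∈ Set.univ ∩ Set.range (e₂ i k), r j) ≤ _) (he₂ i k)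
      rintro _ ⟨-, n, rfl⟩
      simpa [d] using hT i hi (false, k, n)
  have hcard : Cardinal.mk (Bool × K × ℕ) = Cardinal.mk K := by
    have hκ : Cardinal.aleph0 ≤ Cardinal.mk K := Cardinal.aleph0_le_mk K
    have h2 : (2 : Cardinal.{u}) * Cardinal.mk K = Cardinal.mk K :=
      Cardinal.mul_eq_right hκ ((Cardinal.natCast_le_aleph0 (n := 2)).trans hκ) two_ne_zero
    simp [hκ, h2]
  have hcl : ∀ i, ∃ T : Set I, i ∈ T ∧ Stable T ∧ Cardinal.mk T ≤ Cardinal.mk K := fun i =>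
    hcard ▸ exists_closed_set d i
  choose cl hmem hclst hclcard using hcl
  -- Passing from `Tlt i` to `Tle i` adds only elements of `cl i`, hence at most κ blocks.
  let Tle : I → Set I := fun i => ⋃ j : Set.Iic i, cl j
  let Tlt : I → Set I := fun i => ⋃ j : Set.Iio i, cl j
  have hTle : ∀ i, Stable (Tle i) := fun i => hstable _ fun j => hclst j
  have hTlt : ∀ i, Stable (Tlt i) := fun i => hstable _ fun j => hclst j
  have hsub : ∀ i, Tlt i ⊆ Tle i := fun i =>
    Set.iUnion_subset fun j => Set.subset_iUnion_of_subset ⟨j, le_of_lt j.2⟩ subset_rfl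
  have hdiff : ∀ i, Cardinal.mk (Tle i \ Tlt i : Set I) ≤ Cardinal.mk K := by
    intro i
    refine (Cardinal.mk_le_mk_of_subset ?_).trans (hclcard i)
    rintro x ⟨hx, hx'⟩
    obtain ⟨⟨j, hj⟩, hxj⟩ := Set.mem_iUnion.mp hx
    rcases (show j ≤ i from hj).eq_or_lt with rfl | h
    · exact hxj
    · exact (hx' (Set.mem_iUnion.mpr ⟨⟨j, h⟩, hxj⟩)).elim
  have hmono : ∀ i j, i ≤ j → Tle i ⊆ Tle j := fun i j h =>
    Set.iUnion_subset fun k => Set.subset_iUnion_of_subset ⟨k, le_trans k.2 h⟩ subset_rfl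
  refine filtered_of_monotone (M := ModuleCat.of R X) (fun i => (⨆ j ∈ Tle i, r j).map b)
    (fun i j h => Submodule.map_mono (biSup_mono (hmono i j h))) ?_ ?_
  · rw [eq_top_iff]
    have h : LinearMap.range b = ⊤ :=
      LinearMap.range_eq_top.mpr (Function.LeftInverse.surjective hba')
    change ⊤ ≤ ⨆ i, (⨆ j ∈ Tle i, r j).map b
    rw [← h, LinearMap.range_eq_map, ← hg.iSup_range, Submodule.map_iSup]
    refine iSup_mono fun i => Submodule.map_mono ?_
    exact le_biSup r (Set.mem_iUnion.mpr ⟨⟨i, le_refl i⟩, hmem i⟩ : i ∈ Tle i)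
  · intro i
    have hlt : (⨆ j ∈ Set.Iio i, (⨆ k ∈ Tle j, r k).map b) = (⨆ k ∈ Tlt i, r k).map b := by
      simp only [← Submodule.map_iSup]
      congr 1
      apply le_antisymm
      · refine iSup₂_le fun j hj => biSup_mono ?_
        exact Set.iUnion_subset fun k =>
          Set.subset_iUnion_of_subset ⟨k, lt_of_le_of_lt k.2 hj⟩ subset_rfl
      · refine iSup₂_le fun k hk => ?_
        obtain ⟨⟨j, hj⟩, hkj⟩ := Set.mem_iUnion.mp hk
        refine le_trans ?_ (le_biSup (fun j => ⨆ k ∈ Tle j, r k) hj)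
        exact le_biSup r (Set.mem_iUnion.mpr ⟨⟨j, le_refl j⟩, hkj⟩ : k ∈ Tle j)
    change ∃ N : ModuleCat.{u} R, _ ∧ Nonempty (((⨆ j ∈ Tle i, r j).map b ⧸
      (⨆ j ∈ Set.Iio i, (⨆ k ∈ Tle j, r k).map b).submoduleOf _) ≃ₗ[R] N)
    rw [hlt]
    -- The factor of `X` is a retract of a factor of `P` with at most κ blocks, which is ≤
    -- κ-presented and, being `A`-filtered, lies in `A`.
    obtain ⟨h, hh⟩ := (hhill _ (hTlt i)).isBlockSystem hg hrel (hhill _ (hTle i)) (hsub i)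
      (⨆ j ∈ Tlt i, r j) (⨆ j ∈ Tle i, r j) rfl rfl
    obtain ⟨a', b', hba''⟩ := exists_retract_quotient a b hba (⨆ j ∈ Tlt i, r j)
      (⨆ j ∈ Tle i, r j) (hπ _ (hTlt i)) (hπ _ (hTle i))
    have hQ := hh.isLePresented (hdiff i)
    have hQA := hfilt _ (Filtered.mono (fun _ hN => hN.1)
      (HasBlocks.restricted ⟨_, _, inferInstance, h, hh⟩))
    refine ⟨ModuleCat.of R _, ⟨hsumm.retract hQA a' b' hba'', ?_⟩, ⟨LinearEquiv.refl _ _⟩⟩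
    exact hQ.retract (Cardinal.aleph0_le_mk K) a' b' hba''

end

section

variable {R : Type u} [Ring R]

/-! ### Adjoining unknowns subject to well-ordered equations. -/

section System

variable {M V P : Type*} [AddCommGroup M] [Module R M] [AddCommGroup V] [Module R V]

variable (R M V) in
/-- The elements of `M × V^(P)` supported on `T` (with arbitrary component in `M`). -/
noncomputable def supportedOn (T : Set P) : Submodule R (M × (P →₀ V)) :=
  (Finsupp.supported V R T).comap (LinearMap.snd R M (P →₀ V))

theorem apply_eq_zero_of_mem_supportedOn {T : Set P} {e : M × (P →₀ V)}
    (he : e ∈ supportedOn R M V T) {p : P} (hp : p ∉ T) : e.2 p = 0 :=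
  Finsupp.notMem_support_iff.mp fun h => hp ((Finsupp.mem_supported R e.2).mp he h)

theorem supportedOn_mono {T T' : Set P} (h : T ⊆ T') :
    supportedOn R M V T ≤ supportedOn R M V T' :=
  Submodule.comap_mono (Finsupp.supported_mono h)

/-- The map expressing the relations of block `p`: the relation `Rel p x` of the block is identified
with the element `H p x`. -/
noncomputable def relationMap (Rel : P → V →ₗ[R] V) (H : P → V →ₗ[R] M × (P →₀ V)) (p : P) :
    V →ₗ[R] M × (P →₀ V) :=
  LinearMap.inr R M (P →₀ V) ∘ₗ Finsupp.lsingle p ∘ₗ Rel p - H p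

theorem relationMap_apply (Rel : P → V →ₗ[R] V) (H : P → V →ₗ[R] M × (P →₀ V)) (p : P) (x : V) :
    relationMap Rel H p x = (0, Finsupp.single p (Rel p x)) - H p x := rfl

variable [LinearOrder P] {Rel : P → V →ₗ[R] V} {H : P → V →ₗ[R] M × (P →₀ V)}

theorem iSup_range_relationMap_le (hH : ∀ p x, H p x ∈ supportedOn R M V (Set.Iio p))
    {T : Set P} (hT : IsLowerSet T) :
    (⨆ p ∈ T, LinearMap.range (relationMap Rel H p)) ≤ supportedOn R M V T := by
  refine iSup₂_le fun p hp => ?_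
  rintro _ ⟨x, rfl⟩
  rw [relationMap_apply]
  refine sub_mem ?_ (supportedOn_mono (fun q hq => hT (le_of_lt hq) hp) (hH p x))
  exact Finsupp.single_mem_supported R _ hp

/-- If the equations are compatible with the preceding relations, then the relations between
elements supported on a lower set are generated by the relations of that lower set. -/
theorem supportedOn_inf_relations_le [WellFoundedLT P]
    (hH : ∀ p x, H p x ∈ supportedOn R M V (Set.Iio p))
    (hc : ∀ p x, Rel p x = 0 → H p x ∈ ⨆ q ∈ Set.Iio p, LinearMap.range (relationMap Rel H q))
    {T : Set P} (hT : IsLowerSet T) :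
    supportedOn R M V T ⊓ (⨆ p, LinearMap.range (relationMap Rel H p)) ≤
      ⨆ p ∈ T, LinearMap.range (relationMap Rel H p) := by
  have := inf_biSup_le_of_reduction (fun p => LinearMap.range (relationMap Rel H p)) Set.univ
    (supportedOn R M V T) (⨆ p ∈ T, LinearMap.range (relationMap Rel H p)) ?_
  · simpa only [Set.mem_univ, iSup_pos] using this
  intro t _
  by_cases ht : t ∈ T
  · refine le_sup_of_le_left (inf_le_right.trans ?_)
    exact biSup_mono fun p hp => hT hp.2 ht
  · refine le_sup_of_le_right (le_inf inf_le_left ?_)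
    rintro e ⟨heT, he⟩
    rw [biSup_inter_Iic_eq _ _ (Set.mem_univ t)] at he
    simp only [Set.univ_inter] at he ⊢
    obtain ⟨_, ⟨x, rfl⟩, b, hb, rfl⟩ := Submodule.mem_sup.mp he
    -- At coordinate `t ∉ T` only `Rel t x` can contribute, so it vanishes. What is left of the
    -- relation is `-H t x`, which compatibility puts among the earlier relations.
    have h1 := apply_eq_zero_of_mem_supportedOn heT ht
    have h2 := apply_eq_zero_of_mem_supportedOn (hH t x) (lt_irrefl t)
    have h3 := apply_eq_zero_of_mem_supportedOn
      (iSup_range_relationMap_le hH (isLowerSet_Iio t) hb) (lt_irrefl t)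
    have h4 : Rel t x = 0 := by
      simpa [relationMap_apply, h2, h3] using h1
    refine add_mem ?_ hb
    rw [relationMap_apply, h4]
    simpa [← Prod.zero_eq_mk] using hc t x h4

/-- Equations can be made compatible by discarding those that are not. -/
theorem exists_compatible [WellFoundedLT P] (Rel : P → V →ₗ[R] V) (H : P → V →ₗ[R] M × (P →₀ V))
    (hH : ∀ p x, H p x ∈ supportedOn R M V (Set.Iio p)) :
    ∃ H' : P → V →ₗ[R] M × (P →₀ V),
      (∀ p x, H' p x ∈ supportedOn R M V (Set.Iio p)) ∧
      (∀ p x, Rel p x = 0 →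
        H' p x ∈ ⨆ q ∈ Set.Iio p, LinearMap.range (relationMap Rel H' q)) ∧
      ∀ p, (∀ x, Rel p x = 0 →
        H p x ∈ ⨆ q ∈ Set.Iio p, LinearMap.range (relationMap Rel H' q)) → H' p = H p := by
  classical
  -- An incompatible right hand side is replaced by zero. The left hand side stays, so the block of
  -- `p` is unchanged.
  let step : ∀ p, (∀ q, q < p → V →ₗ[R] M × (P →₀ V)) → V →ₗ[R] M × (P →₀ V) := fun p ih =>
    if ∀ x, Rel p x = 0 → H p x ∈ ⨆ (q : P) (hq : q < p), LinearMap.range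
      (LinearMap.inr R M (P →₀ V) ∘ₗ Finsupp.lsingle q ∘ₗ Rel q - ih q hq) then H p else 0
  let H' : P → V →ₗ[R] M × (P →₀ V) := (wellFounded_lt (α := P)).fix step
  have hfix : ∀ p, H' p = if ∀ x, Rel p x = 0 →
      H p x ∈ ⨆ q ∈ Set.Iio p, LinearMap.range (relationMap Rel H' q) then H p else 0 :=
    fun p => (wellFounded_lt (α := P)).fix_eq step p
  refine ⟨H', fun p x => ?_, fun p x hx => ?_, fun p hp => ?_⟩
  · rw [hfix]
    split_ifs
    · exact hH p x
    · exact zero_mem _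
  · by_cases h : ∀ x, Rel p x = 0 →
      H p x ∈ ⨆ q ∈ Set.Iio p, LinearMap.range (relationMap Rel H' q)
    · have h' := hfix p
      rw [if_pos h] at h'
      rw [h']; exact h x hx
    · have h' := hfix p
      rw [if_neg h] at h'
      rw [h']; exact zero_mem _
  · have h' := hfix p
    rwa [if_pos hp] at h'

end System

/-! ### Formal systems of equations. -/

section EquationBlock

/-- Formal systems of equations, indexed by `K`, whose right hand sides are linear combinations of
elements of `M` and of the unknowns (indexed by `K`) of other such systems; each system carries a
label in `J` for its left hand side. -/
inductive EquationBlock (J K S M : Type u) : Type u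
  -- Right hand sides are finite lists of terms: coefficient `c` times unknown `i` of system `b`.
  -- Finitely supported functions on the type itself would violate strict positivity.
  | mk (j : J) (m : K → M) (n : K → ℕ) (c : ∀ k, Fin (n k) → S) (i : ∀ k, Fin (n k) → K)
    (b : ∀ k, Fin (n k) → EquationBlock J K S M) : EquationBlock J K S M

namespace EquationBlock

variable {J K S M : Type u}

/-- The label of a system of equations. -/
def label : EquationBlock J K S M → J
  | mk j _ _ _ _ _ => j

/-- The systems occurring in the right hand sides of a given one. -/
def Occurs (p : EquationBlock J K S M) : EquationBlock J K S M → Prop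
  | mk _ _ n _ _ b => ∃ (k : K) (l : Fin (n k)), b k l = p

theorem wellFounded_occurs : WellFounded (Occurs (S := S) (J := J) (K := K) (M := M)) := by
  refine ⟨fun p => ?_⟩
  induction p with
  | mk j m n c i b ih =>
    refine ⟨_, ?_⟩
    rintro _ ⟨k, l, rfl⟩
    exact ih k l

/-- The right hand sides of a system of equations. -/
noncomputable def rhs : EquationBlock J K R M → K → M × (EquationBlock J K R M →₀ (K →₀ R))
  | mk _ m _ c i b => fun k => (m k, ∑ l, Finsupp.single (b k l) (Finsupp.single (i k l) (c k l)))

theorem rhs_mem_supportedOn [AddCommGroup M] [Module R M] (p : EquationBlock J K R M) (k : K) :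
    p.rhs k ∈ supportedOn R M (K →₀ R) {q | Occurs q p} := by
  cases p with
  | mk j m n c i b =>
    change (∑ l, Finsupp.single (b k l) (Finsupp.single (i k l) (c k l))) ∈
      Finsupp.supported (K →₀ R) R _
    exact Submodule.sum_mem _ fun l _ => Finsupp.single_mem_supported R _ ⟨k, l, rfl⟩

theorem exists_eq_sum_single {P : Type*} (v : P →₀ (K →₀ R)) :
    ∃ (n : ℕ) (c : Fin n → R) (i : Fin n → K) (b : Fin n → P),
      v = ∑ l, Finsupp.single (b l) (Finsupp.single (i l) (c l)) := by
  have hadd : ∀ v w : P →₀ (K →₀ R),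
      (∃ (n : ℕ) (c : Fin n → R) (i : Fin n → K) (b : Fin n → P),
        v = ∑ l, Finsupp.single (b l) (Finsupp.single (i l) (c l))) →
      (∃ (n : ℕ) (c : Fin n → R) (i : Fin n → K) (b : Fin n → P),
        w = ∑ l, Finsupp.single (b l) (Finsupp.single (i l) (c l))) →
      ∃ (n : ℕ) (c : Fin n → R) (i : Fin n → K) (b : Fin n → P),
        v + w = ∑ l, Finsupp.single (b l) (Finsupp.single (i l) (c l)) := by
    rintro _ _ ⟨n, c, i, b, rfl⟩ ⟨n', c', i', b', rfl⟩
    refine ⟨n + n', Fin.append c c', Fin.append i i', Fin.append b b', ?_⟩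
    simp [Fin.sum_univ_add]
  have hzero : ∃ (n : ℕ) (c : Fin n → R) (i : Fin n → K) (b : Fin n → P),
      (0 : P →₀ (K →₀ R)) = ∑ l, Finsupp.single (b l) (Finsupp.single (i l) (c l)) :=
    ⟨0, Fin.elim0, Fin.elim0, Fin.elim0, by simp⟩
  induction v using Finsupp.induction_linear with
  | zero => exact hzero
  | add v w hv hw => exact hadd v w hv hw
  | single p x =>
    induction x using Finsupp.induction_linear with
    | zero => rw [Finsupp.single_zero]; exact hzero
    | add x y hx hy => rw [Finsupp.single_add]; exact hadd _ _ hx hy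
    | single k r => exact ⟨1, fun _ => r, fun _ => k, fun _ => p, by simp⟩

/-- The type already contains every system with unknowns in itself. This replaces the cofinality
argument of a transfinite iteration. -/
theorem exists_rhs_eq (j : J) (h : K → M × (EquationBlock J K R M →₀ (K →₀ R))) :
    ∃ p : EquationBlock J K R M, p.label = j ∧ p.rhs = h := by
  choose n c i b hb using fun k => exists_eq_sum_single (h k).2
  exact ⟨mk j (fun k => (h k).1) n c i b, rfl, funext fun k => Prod.ext rfl (hb k).symm⟩

end EquationBlock

end EquationBlock

/-! ### Special preenvelopes. -/

set_option maxSynthPendingDepth 3 in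
/-- Every module embeds into a module in `(A^{≤ κ})^⊥` with a cokernel that has a block system. -/
theorem exists_special_preenvelope {K : Type u} [Infinite K] {A : ObjectProperty (ModuleCat.{u} R)}
    (hA : ClosedUnderDirectSummands A) (M : Type u) [AddCommGroup M] [Module R M] :
    ∃ (Y Z : ModuleCat.{u} R) (f : M →ₗ[R] Y) (g : Y →ₗ[R] Z), Function.Injective f ∧
      Function.Surjective g ∧ Function.Exact f g ∧ HasBlocks A K Z ∧
      rightPerp (lePresented A (Cardinal.mk K)) Y := by
  let J : Type u := {rel : K → (K →₀ R) //
    A (ModuleCat.of R ((K →₀ R) ⧸ Submodule.span R (Set.range rel)))}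
  let P := EquationBlock J K R M
  have hwf : IsWellFounded P EquationBlock.Occurs := ⟨EquationBlock.wellFounded_occurs⟩
  let : LinearOrder P := IsWellFounded.wellOrderExtension EquationBlock.Occurs
  have : WellFoundedLT P := IsWellFounded.wellOrderExtension.isWellFounded_lt EquationBlock.Occurs
  have hlt : ∀ p q : P, p.Occurs q → p < q := fun p q h =>
    Prod.Lex.left _ _ (IsWellFounded.rank_lt_of_rel h)
  let Rel : P → (K →₀ R) →ₗ[R] (K →₀ R) := fun p => Finsupp.linearCombination R p.label.1
  let H₀ : P → (K →₀ R) →ₗ[R] M × (P →₀ (K →₀ R)) := fun p => Finsupp.linearCombination R p.rhs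
  have hH₀ : ∀ p x, H₀ p x ∈ supportedOn R M (K →₀ R) (Set.Iio p) := by
    intro p x
    have hle : Submodule.span R (Set.range p.rhs) ≤
        supportedOn R M (K →₀ R) (Set.Iio p) := by
      rw [Submodule.span_le]
      rintro _ ⟨k, rfl⟩
      exact supportedOn_mono (fun q hq => hlt q p hq) (p.rhs_mem_supportedOn k)
    refine hle ?_
    rw [← Finsupp.range_linearCombination]
    exact LinearMap.mem_range_self (H₀ p) x
  obtain ⟨H, hH, hc, hH₀H⟩ := exists_compatible Rel H₀ hH₀
  let L : Submodule R (M × (P →₀ (K →₀ R))) := ⨆ p, LinearMap.range (relationMap Rel H p)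
  have hL : ∀ {T : Set P}, IsLowerSet T → ∀ {e}, e ∈ supportedOn R M (K →₀ R) T → e ∈ L →
      e ∈ ⨆ p ∈ T, LinearMap.range (relationMap Rel H p) := fun hT _ h h' =>
    supportedOn_inf_relations_le hH hc hT ⟨h, h'⟩
  have hρL : ∀ p x, relationMap Rel H p x ∈ L := fun p x =>
    Submodule.mem_iSup_of_mem p ⟨x, rfl⟩
  let Z := (P →₀ (K →₀ R)) ⧸ L.map (LinearMap.snd R M _)
  let f : M →ₗ[R] (M × (P →₀ (K →₀ R))) ⧸ L := L.mkQ ∘ₗ LinearMap.inl R M _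
  let g : ((M × (P →₀ (K →₀ R))) ⧸ L) →ₗ[R] Z :=
    L.mapQ (L.map (LinearMap.snd R M _)) (LinearMap.snd R M _) (Submodule.le_comap_map _ _)
  refine ⟨ModuleCat.of R ((M × (P →₀ (K →₀ R))) ⧸ L), ModuleCat.of R Z, f, g, ?_, ?_, ?_, ?_, ?_⟩
  · rw [injective_iff_map_eq_zero]
    intro m hm
    have h1 : (m, 0) ∈ L := (Submodule.Quotient.mk_eq_zero L).mp hm
    -- An element of `M` involves no unknowns, and the empty set of systems yields no relations.
    have h2 := hL (T := ∅) (fun _ _ _ h => h) (e := (m, 0)) (zero_mem (Finsupp.supported _ R _)) h1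
    simpa using h2
  · intro z
    obtain ⟨v, rfl⟩ := Submodule.mkQ_surjective _ z
    exact ⟨Submodule.Quotient.mk (0, v), rfl⟩
  · intro y
    obtain ⟨⟨m, v⟩, rfl⟩ := Submodule.mkQ_surjective _ y
    constructor
    · intro h
      obtain ⟨⟨m', v'⟩, he, rfl⟩ := (Submodule.Quotient.mk_eq_zero _).mp h
      refine ⟨m - m', ?_⟩
      refine ((Submodule.Quotient.eq L).mpr ?_).symm
      simpa using he
    · rintro ⟨m', hm'⟩
      rw [← hm']
      exact (Submodule.Quotient.mk_eq_zero _).mpr (zero_mem _)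
  · let gz : P → (K →₀ R) →ₗ[R] Z := fun p => Submodule.mkQ _ ∘ₗ Finsupp.lsingle p
    have hsupp : ∀ p : P, (⨆ q ∈ Set.Iio p, LinearMap.range
        (Finsupp.lsingle q : (K →₀ R) →ₗ[R] P →₀ (K →₀ R))) =
        Finsupp.supported (K →₀ R) R (Set.Iio p) := by
      intro p
      apply le_antisymm
      · refine iSup₂_le fun q hq => ?_
        rintro _ ⟨x, rfl⟩
        exact Finsupp.single_mem_supported R _ hq
      · intro v hv
        rw [← Finsupp.sum_single v]
        refine Submodule.sum_mem _ fun q hq => ?_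
        exact le_biSup (fun q => LinearMap.range
          (Finsupp.lsingle q : (K →₀ R) →ₗ[R] P →₀ (K →₀ R)))
          ((Finsupp.mem_supported R v).mp hv hq) ⟨v q, rfl⟩
    have hcomap : ∀ p, (⨆ q ∈ Set.Iio p, LinearMap.range (gz q)).comap (gz p) =
        Submodule.span R (Set.range p.label.1) := by
      intro p
      have h1 : (⨆ q ∈ Set.Iio p, LinearMap.range (gz q)) =
          (Finsupp.supported (K →₀ R) R (Set.Iio p)).map (L.map (LinearMap.snd R M _)).mkQ := by
        rw [← hsupp]
        simp only [Submodule.map_iSup, ← LinearMap.range_comp]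
        rfl
      rw [h1, Submodule.comap_comp, Submodule.comap_map_eq, Submodule.ker_mkQ]
      ext x
      rw [Submodule.mem_comap, Submodule.mem_sup, ← Finsupp.range_linearCombination]
      constructor
      · rintro ⟨v, hv, _, ⟨e, heL, rfl⟩, hx⟩
        have hvp : v p = 0 := Finsupp.notMem_support_iff.mp fun h =>
          lt_irrefl p ((Finsupp.mem_supported R v).mp hv h)
        have he : e ∈ supportedOn R M (K →₀ R) (Set.Iic p) := by
          change e.2 ∈ Finsupp.supported (K →₀ R) R (Set.Iic p)
          have h2 : e.2 = Finsupp.single p x - v := eq_sub_of_add_eq' hx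
          rw [h2]
          exact sub_mem (Finsupp.single_mem_supported R _ (le_refl p))
            (Finsupp.supported_mono Set.Iio_subset_Iic_self hv)
        -- With later relations excluded, coordinate `p` shows that `x` is a value of `Rel p`.
        have he' := hL (isLowerSet_Iic p) he heL
        have h3 := biSup_inter_Iic_eq (fun p => LinearMap.range (relationMap Rel H p)) Set.univ
          (Set.mem_univ p)
        simp only [Set.univ_inter] at h3
        rw [h3] at he'
        obtain ⟨_, ⟨y, rfl⟩, b, hb, rfl⟩ := Submodule.mem_sup.mp he'
        have h4 := apply_eq_zero_of_mem_supportedOn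
          (iSup_range_relationMap_le hH (isLowerSet_Iio p) hb) (lt_irrefl p)
        have h5 := apply_eq_zero_of_mem_supportedOn (hH p y) (lt_irrefl p)
        refine ⟨y, ?_⟩
        have h6 := DFunLike.congr_fun hx p
        simpa [relationMap_apply, hvp, h4, h5] using h6
      · rintro ⟨y, rfl⟩
        refine ⟨(H p y).2, hH p y, _, Submodule.mem_map_of_mem (hρL p y), ?_⟩
        simp [relationMap_apply, Rel]
    refine ⟨P, inferInstance, inferInstance, gz, ?_, ?_, ?_⟩
    · rw [eq_top_iff]
      intro z _
      obtain ⟨v, rfl⟩ := Submodule.mkQ_surjective _ z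
      rw [← Finsupp.sum_single v, Finsupp.sum, map_sum]
      exact Submodule.sum_mem _ fun p _ => Submodule.mem_iSup_of_mem p ⟨v p, rfl⟩
    · intro p
      rw [hcomap]
      exact ⟨_, rfl⟩
    · intro p
      rw [hcomap]
      exact p.label.2
  · rintro X ⟨hXA, hX⟩
    obtain ⟨q, rel, hq, hrel⟩ := hX.exists_presentation
    have hj : A (ModuleCat.of R ((K →₀ R) ⧸ Submodule.span R (Set.range rel))) := by
      rw [hrel]
      exact hA.of_linearEquiv hXA (q.quotKerEquivOfSurjective hq).symm
    refine subsingleton_ext_of_exists_extension q hq fun φ => ?_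
    have hrelker : ∀ k, rel k ∈ LinearMap.ker q := fun k =>
      hrel ▸ Submodule.subset_span ⟨k, rfl⟩
    -- Lifts of the values of `φ` on the relations serve as right hand sides of a system `p`, whose
    -- unknowns will be the values of the extension.
    choose h hh using fun k => Submodule.mkQ_surjective L (φ ⟨rel k, hrelker k⟩)
    obtain ⟨p, hpl, hpr⟩ := EquationBlock.exists_rhs_eq (R := R) (⟨rel, hj⟩ : J) h
    have hRel : ∀ x, Rel p x ∈ LinearMap.ker q := fun x => by
      rw [← hrel, ← Finsupp.range_linearCombination]
      exact ⟨x, by simp [Rel, hpl]⟩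
    have hφ : ∀ x, L.mkQ (H₀ p x) = φ ⟨Rel p x, hRel x⟩ := by
      have : L.mkQ ∘ₗ H₀ p = φ ∘ₗ (Rel p).codRestrict _ hRel := by
        ext k
        simp only [LinearMap.comp_apply, H₀, Finsupp.lsingle_apply,
          Finsupp.linearCombination_single, one_smul, hpr, hh]
        congr 1
        ext1
        simp [Rel, hpl]
      exact LinearMap.congr_fun this
    -- The system was not discarded: if `Rel p x = 0`, then `H₀ p x` represents `φ 0 = 0`, so it
    -- lies in `L`, and hence in the relations of systems up to `p`.
    have hHp : H p = H₀ p := by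
      -- The bound must be strict, so the lower set needed is that of the systems before `p`.
      refine hH₀H p fun x hx => hL (isLowerSet_Iio p) (hH₀ p x) ?_
      rw [← Submodule.ker_mkQ L, LinearMap.mem_ker, hφ]
      have : (⟨Rel p x, hRel x⟩ : LinearMap.ker q) = 0 := Subtype.ext hx
      rw [this, map_zero]
    refine ⟨L.mkQ ∘ₗ LinearMap.inr R M _ ∘ₗ Finsupp.lsingle p, ?_⟩
    ext ⟨y, hy⟩
    obtain ⟨x, rfl⟩ : ∃ x, Rel p x = y := by
      rw [← hrel, ← Finsupp.range_linearCombination] at hy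
      obtain ⟨x, hx⟩ := hy
      exact ⟨x, by simpa [Rel, hpl] using hx⟩
    rw [← hφ, ← hHp]
    refine (Submodule.Quotient.eq L).mpr ?_
    exact hρL p x

end

/-! ### The cotorsion pair. -/

section

variable {R : Type u} [Ring R] {A : ObjectProperty (ModuleCat.{u} R)} {K : Type u}

/-- A `≤ κ`-presented member of `A` has a block system with a single block. -/
theorem hasBlocks_of_lePresented [Infinite K] (hA : ClosedUnderDirectSummands A)
    {M : ModuleCat.{u} R} (hM : lePresented A (Cardinal.mk K) M) : HasBlocks A K M := by
  obtain ⟨f, rel, hf, hrel⟩ := hM.2.exists_presentation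
  have hbot : ∀ i : PUnit.{u + 1},
      (⨆ j ∈ Set.Iio i, LinearMap.range f).comap f = LinearMap.ker f := fun i => by
    have : Set.Iio i = ∅ := by ext j; simp
    rw [this]
    simp
  refine ⟨PUnit, inferInstance, inferInstance, fun _ => f, ?_, fun i => ?_, fun i => ?_⟩
  · simpa using LinearMap.range_eq_top.mpr hf
  · exact ⟨rel, hrel.trans (hbot i).symm⟩
  · rw [hbot]
    exact hA.of_linearEquiv hM.1 (f.quotKerEquivOfSurjective hf).symm

theorem restricted_le_leftPerp {κ : Cardinal.{u}} {M : ModuleCat.{u} R} (hM : restricted A κ M) :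
    leftPerp (rightPerp (lePresented A κ)) M :=
  fun _ hN => subsingleton_ext_of_filtered hM hN

/-- The left orthogonal class of `(A^{≤ κ})^⊥` consists of modules filtered by `A^{≤ κ}`. -/
theorem leftPerp_rightPerp_le_restricted [Infinite K]
    (hfilt : ClosedUnderTransfiniteExtensions A) (hsumm : ClosedUnderDirectSummands A)
    (hR : A (ModuleCat.of R R)) {X : ModuleCat.{u} R}
    (hX : leftPerp (rightPerp (lePresented A (Cardinal.mk K))) X) :
    restricted A (Cardinal.mk K) X := by
  let p : (X →₀ R) →ₗ[R] X := Finsupp.linearCombination R id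
  have hp : Function.Surjective p := Finsupp.linearCombination_id_surjective R X
  obtain ⟨Y, Z, f, w, hf, hw, hfw, hZ, hY⟩ :=
    exists_special_preenvelope (K := K) hsumm (LinearMap.ker p)
  obtain ⟨g, hg⟩ := exists_extension_of_subsingleton_ext (A := LinearMap.ker p) (X := X) (N := Y)
    (hX Y hY)
    (LinearMap.ker p).subtype p Subtype.val_injective hp
    (LinearMap.exact_subtype_ker_map p) f
  have hg' : ∀ x (hx : p x = 0), g x = f ⟨x, hx⟩ := fun x hx => LinearMap.congr_fun hg ⟨x, hx⟩
  have hker : LinearMap.ker p ≤ LinearMap.ker (w ∘ₗ g) := fun x hx => by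
    rw [LinearMap.mem_ker, LinearMap.comp_apply, hg' x hx]
    exact (hfw _).mpr ⟨_, rfl⟩
  let θ : X →ₗ[R] Z := (LinearMap.ker p).liftQ (w ∘ₗ g) hker ∘ₗ
    (p.quotKerEquivOfSurjective hp).symm.toLinearMap
  have hθ : ∀ x, θ (p x) = w (g x) := fun x => by
    have : (p.quotKerEquivOfSurjective hp).symm (p x) = Submodule.Quotient.mk x := by
      rw [LinearEquiv.symm_apply_eq]; rfl
    simp only [θ, LinearMap.comp_apply, LinearEquiv.coe_coe, this]
    rfl
  -- The extension `g` of `f` splits the pushout of the free module and `Y`, identifying it with `Y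
  -- × X`; its quotient by the free module is `Z`.
  have hblocks : HasBlocks A K (Y × X) := by
    refine (hasBlocks_finsupp hsumm hR X).extension hZ (g.prod p)
      (w ∘ₗ LinearMap.fst R Y X - θ ∘ₗ LinearMap.snd R Y X) ?_ ?_ ?_
    · rw [injective_iff_map_eq_zero]
      intro x hx
      have h1 : g x = 0 := congrArg Prod.fst hx
      have h2 : p x = 0 := congrArg Prod.snd hx
      rw [hg' x h2, map_eq_zero_iff f hf] at h1
      exact congrArg Subtype.val h1
    · intro z
      obtain ⟨y, rfl⟩ := hw z
      exact ⟨(y, 0), by simp⟩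
    · rintro ⟨y, x⟩
      constructor
      · intro h
        obtain ⟨x, rfl⟩ := hp x
        have h1 : w (y - g x) = 0 := by
          rw [map_sub, ← hθ]
          exact h
        obtain ⟨k, hk⟩ := (hfw _).mp h1
        refine ⟨x + k, ?_⟩
        have hk' := hg' k.1 k.2
        ext
        · change g (x + k) = y
          rw [map_add, hk']
          change g x + f k = y
          rw [hk]; abel
        · change p (x + k) = p x
          rw [map_add, show p k = 0 from k.2, add_zero]
      · rintro ⟨x', hx'⟩
        rw [← hx']
        simp [hθ]
  exact hblocks.restricted_of_retract hfilt hsumm (LinearMap.inr R Y X) (LinearMap.snd R Y X)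
    (by ext; rfl)

end

end ModClass

theorem lemma2p2 {R : Type u} [Ring R] (κ : Cardinal.{u}) (hκ : Cardinal.aleph0 ≤ κ)
    (A : ObjectProperty (ModuleCat.{u} R))
    (hfilt : ModClass.ClosedUnderTransfiniteExtensions A)
    (hsumm : ModClass.ClosedUnderDirectSummands A)
    (hR : A (ModuleCat.of R R)) :
    ModClass.IsCompleteCotorsionPair (ModClass.restricted A κ)
      (ModClass.rightPerp (ModClass.lePresented A κ)) := by
  induction κ using Cardinal.inductionOn with
  | mk K =>
  have : Infinite K := Cardinal.infinite_iff.mpr hκ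
  refine ⟨⟨?_, ?_⟩, fun M => ?_⟩
  · ext X
    exact ⟨ModClass.restricted_le_leftPerp,
      ModClass.leftPerp_rightPerp_le_restricted hfilt hsumm hR⟩
  · ext N
    exact ⟨fun hN X hX => ModClass.restricted_le_leftPerp hX N hN,
      fun hN X hX => hN X (ModClass.hasBlocks_of_lePresented hsumm hX).restricted⟩
  · obtain ⟨Y, Z, f, g, hf, hg, hfg, hZ, hY⟩ :=
      ModClass.exists_special_preenvelope (K := K) hsumm M
    exact ⟨Y, Z, ModuleCat.ofHom f, ModuleCat.ofHom g,
      by ext x; exact (hfg (f x)).mpr ⟨x, rfl⟩, hY, hZ.restricted,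
      ModuleCat.shortComplex_shortExact _ hfg hf hg⟩
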